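/- Let $p$ be a prime, $n\ge 1$, $d^nx$ the Haar measure on $\mathbb{Q}_p^n$ giving $\mathbb{Z}_p^n$ volume $1$, $\|x\|_p=\max_i|x_i|_p$, and $\Psi(y)=e^{2\pi i\{y\}_p}$ with $\{y\}_p$ the $p$-adic fractional part. Let $S$ be the space of Bruhat–Schwartz functions (locally constant $\varphi:\mathbb{Q}_p^n\to\mathbb{C}$ with compact support), $(\mathcal{F}\varphi)(\xi)=\int\Psi(-\xi\cdot x)\varphi(x)\,d^nx$ with inverse $(\mathcal{F}^{-1}g)(x)=\int\Psi(\xi\cdot x)g(\xi)\,d^n\xi$, and denote by $\mathcal{F}$ also the Fourier transform on $L^2=L^2(\mathbb{Q}_p^n)$, i.e. the distributional one, $\int(\mathcal{F}f)\varphi=\int f\,\mathcal{F}\varphi$ for all $\varphi\in S$. Let $w:\mathbb{Q}_p^n\to[0,\infty)$ be continuous and radial (a function of $\|y\|_p$), with $w(y)=0$ if and only if $y=0$, and suppose there are constants $C_0>0$, $M\in\mathbb{Z}$, $\alpha_1>n$ with $w(y)\ge C_0\|y\|_p^{\alpha_1}$ whenever $\|y\|_p\ge p^M$. Let $\kappa>0$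 and put $$(W\varphi)(x)=\kappa\int_{\mathbb{Q}_p^n}\frac{\varphi(x-y)-\varphi(x)}{w(y)}\,d^ny\quad(\varphi\in S),\qquad A_w(\xi)=\int_{\mathbb{Q}_p^n}\frac{1-\Psi(-y\cdot\xi)}{w(y)}\,d^ny .$$ These integrals converge absolutely, and $A_w(\xi)$ depends on $\|\xi\|_p$ only. Moreover: (i) For every $\varphi\in S$ the function $A_w\mathcal{F}\varphi$ is integrable, $W\varphi=-\kappa\,\mathcal{F}^{-1}(A_w\,\mathcal{F}\varphi)$, and $W\varphi\in C(\mathbb{Q}_p^n)\cap L^\rho(\mathbb{Q}_p^n)$ for all $1\le\rho\le\infty$. The operator $W$ extends to a densely defined (in general unbounded) linear operator in $L^2$, again denoted $W$, with domain $\mathrm{Dom}(W)=\{f\in L^2: A_w\mathcal{F}f\in L^2\}$, satisfying $\mathcal{F}(Wf)=-\kappa A_w\mathcal{F}f$ for $f\in\mathrm{Dom}(W)$. (ii) $(-W,\mathrm{Dom}(W))$ is self-adjoint and positive, i.e. $\langle -Wf,f\rangle\ge 0$ for all $f\in\mathrm{Dom}(W)$. (iii) $W$ is the infinitesimal generator of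 a contraction $C_0$ semigroup $(\mathcal{T}(t))_{t\ge0}$ on $L^2$. This semigroup is bounded holomorphic with angle $\pi/2$: it extends to a family of bounded operators $\mathcal{T}(z)$, $z\in\Sigma_{\pi/2}\cup\{0\}$, where $\Sigma_\delta=\{z\ne0:|\arg z|<\delta\}$, which has the semigroup property and is holomorphic on $\Sigma_{\pi/2}$ and, for every $0<\delta'<\pi/2$, is bounded on $\Sigma_{\delta'}$ and satisfies $\mathcal{T}(z)f\to f$ as $z\to0$ in $\Sigma_{\delta'}$ for all $f\in L^2$. -/

import Mathlib

open MeasureTheory Filter Topology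
open scoped ENNReal NNReal

noncomputable section

namespace PadicNonlocal

/-! ### The space `ℚ_p^n` and its Haar measure -/

/-- The Borel `σ`-algebra of `ℚ_p`. -/
instance instMeasurableSpacePadic (p : ℕ) [Fact p.Prime] : MeasurableSpace ℚ_[p] := borel _

instance instBorelSpacePadic (p : ℕ) [Fact p.Prime] : BorelSpace ℚ_[p] := ⟨rfl⟩

/-- The space `ℚ_p^n`. As a `Pi` type it carries the norm `‖x‖_p = max_i |x_i|_p`. -/
abbrev Qpn (p : ℕ) [Fact p.Prime] (n : ℕ) : Type := Fin n → ℚ_[p]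

/-- The unit ball `B_0^n` of `ℚ_p^n`, as a compact set with nonempty interior. -/
def unitBall (p : ℕ) [Fact p.Prime] (n : ℕ) : TopologicalSpace.PositiveCompacts (Qpn p n) where
  carrier := Metric.closedBall 0 1
  isCompact' := isCompact_closedBall 0 1
  interior_nonempty' :=
    ⟨0, Metric.ball_subset_interior_closedBall (Metric.mem_ball_self one_pos)⟩

/-- The Haar measure `d^n x` on `ℚ_p^n`, normalized by `vol (B_0^n) = 1`. -/
def haar (p : ℕ) [Fact p.Prime] (n : ℕ) : Measure (Qpn p n) := Measure.addHaarMeasure (unitBall p n)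

/-- The complex Hilbert space `L²(ℚ_p^n, d^n x)`. -/
abbrev L2 (p : ℕ) [Fact p.Prime] (n : ℕ) : Type := Lp ℂ 2 (haar p n)

/-! ### Additive character, test functions, Fourier transform -/

/-- For `k = max (-ord x) 0` the number `p ^ k * x` is a `p`-adic integer. -/
theorem norm_pow_mul_le_one {p : ℕ} [Fact p.Prime] (x : ℚ_[p]) :
    ‖(p : ℚ_[p]) ^ (-x.valuation).toNat * x‖ ≤ 1 := by
  rcases eq_or_ne x 0 with rfl | hx
  · simp
  · have hp : (1 : ℝ) ≤ p := by exact_mod_cast (Fact.out : p.Prime).one_lt.le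
    have hp0 : (p : ℝ) ≠ 0 := by positivity
    rw [norm_mul, norm_pow, Padic.norm_p, Padic.norm_eq_zpow_neg_valuation hx, inv_pow,
      ← zpow_natCast, ← zpow_neg, ← zpow_add₀ hp0]
    exact zpow_le_one_of_nonpos₀ hp (by omega)

/-- The fractional part `{x}_p = p ^ ord(x) * ∑_{0 ≤ j < -ord(x)} x_j p ^ j` of a `p`-adic number
`x = p ^ ord(x) * ∑_{j ≥ 0} x_j p ^ j` (and `{x}_p = 0` if `x = 0` or `ord(x) ≥ 0`). With
`k = max (-ord x) 0`, the sum is the truncation at `p ^ k` of the `p`-adic integer `p ^ k * x`. -/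
def fracPart {p : ℕ} [Fact p.Prime] (x : ℚ_[p]) : ℚ :=
  (PadicInt.appr (⟨(p : ℚ_[p]) ^ (-x.valuation).toNat * x, norm_pow_mul_le_one x⟩ : ℤ_[p])
    (-x.valuation).toNat : ℚ) / (p : ℚ) ^ (-x.valuation).toNat

/-- The additive character `Ψ(y) = exp (2 π i {y}_p)` of `ℚ_p`. -/
def Psi {p : ℕ} [Fact p.Prime] (y : ℚ_[p]) : ℂ :=
  Complex.exp (2 * Real.pi * Complex.I * (fracPart y : ℂ))

/-- The pairing `ξ · x = ∑_j ξ_j x_j`. -/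
def dot {p : ℕ} [Fact p.Prime] {n : ℕ} (ξ x : Qpn p n) : ℚ_[p] := ∑ j, ξ j * x j

/-- Bruhat–Schwartz functions: locally constant with compact support. -/
def IsTestFunction {p : ℕ} [Fact p.Prime] {n : ℕ} (φ : Qpn p n → ℂ) : Prop :=
  IsLocallyConstant φ ∧ HasCompactSupport φ

/-- The Fourier integral `(𝓕 φ)(ξ) = ∫ Ψ(-ξ · x) φ(x) d^n x`. -/
def fourierIntegral {p : ℕ} [Fact p.Prime] {n : ℕ} (φ : Qpn p n → ℂ) (ξ : Qpn p n) : ℂ :=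
  ∫ x, Psi (-dot ξ x) * φ x ∂(haar p n)

/-- The inverse Fourier integral `(𝓕⁻¹ g)(x) = ∫ Ψ(ξ · x) g(ξ) d^n ξ`. -/
def invFourierIntegral {p : ℕ} [Fact p.Prime] {n : ℕ} (g : Qpn p n → ℂ) (x : Qpn p n) : ℂ :=
  ∫ ξ, Psi (dot ξ x) * g ξ ∂(haar p n)

/-- The functions `f, g ∈ L²` satisfy `𝓕 f = g`, in the sense of distributions:
`(g, φ) = (f, 𝓕 φ)` for all test functions `φ`. -/
def IsFourierL2 {p : ℕ} [Fact p.Prime] {n : ℕ} (f g : Qpn p n → ℂ) : Prop :=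
  MemLp f 2 (haar p n) ∧ MemLp g 2 (haar p n) ∧
    ∀ φ : Qpn p n → ℂ, IsTestFunction φ →
      ∫ ξ, g ξ * φ ξ ∂(haar p n) = ∫ x, f x * fourierIntegral φ x ∂(haar p n)

/-! ### The nonlocal operator and its symbol -/

/-- The standing conditions on the function `w : ℚ_p^n → ℝ_+`. -/
structure IsAdmissible {p : ℕ} [Fact p.Prime] {n : ℕ} (w : Qpn p n → ℝ) : Prop where
  nonneg : ∀ y, 0 ≤ w y
  radial : ∀ y z, ‖y‖ = ‖z‖ → w y = w z
  continuous : Continuous w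
  eq_zero_iff : ∀ y, w y = 0 ↔ y = 0
  growth : ∃ (C₀ : ℝ) (M : ℤ) (α₁ : ℝ), 0 < C₀ ∧ (n : ℝ) < α₁ ∧
    ∀ y, (p : ℝ) ^ M ≤ ‖y‖ → C₀ * ‖y‖ ^ α₁ ≤ w y

/-- `(W φ)(x) = κ ∫ (φ(x - y) - φ(x)) / w(y) d^n y`. -/
def nonlocalOp {p : ℕ} [Fact p.Prime] {n : ℕ} (κ : ℝ) (w : Qpn p n → ℝ) (φ : Qpn p n → ℂ)
    (x : Qpn p n) : ℂ :=
  κ * ∫ y, (φ (x - y) - φ x) / (w y : ℂ) ∂(haar p n)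

/-- `A_w(ξ) = ∫ (1 - Ψ(-y · ξ)) / w(y) d^n y`. -/
def symbolA {p : ℕ} [Fact p.Prime] {n : ℕ} (w : Qpn p n → ℝ) (ξ : Qpn p n) : ℂ :=
  ∫ y, (1 - Psi (-dot y ξ)) / (w y : ℂ) ∂(haar p n)

/-! ### Operator semigroups -/

/-- `C₀` semigroups of bounded operators on a complex Banach space. -/
structure IsC0Semigroup {E : Type*} [NormedAddCommGroup E] [NormedSpace ℂ E]
    (T : ℝ≥0 → E →L[ℂ] E) : Prop where
  map_zero : T 0 = ContinuousLinearMap.id ℂ E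
  map_add : ∀ s t, T (s + t) = (T s).comp (T t)
  continuous : ∀ x, Continuous fun t => T t x

/-- `A` is the infinitesimal generator of `T`: `x ∈ Dom(A)` and `A x = y` if and only if
`(T(t) x - x) / t → y` as `t → 0+`. -/
def IsGenerator {E : Type*} [NormedAddCommGroup E] [NormedSpace ℂ E]
    (A : E →ₗ.[ℂ] E) (T : ℝ≥0 → E →L[ℂ] E) : Prop :=
  ∀ x y : E, (x, y) ∈ A.graph ↔
    Tendsto (fun t : ℝ≥0 => ((t : ℝ)⁻¹ : ℂ) • (T t x - x)) (𝓝[>] 0) (𝓝 y)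

/-- The open sector `{z ≠ 0 : |arg z| < δ}`. -/
def sector (δ : ℝ) : Set ℂ := {z | z ≠ 0 ∧ |z.arg| < δ}

/-- The semigroup `T` is bounded holomorphic with angle `δ ∈ (0, π/2]`: it extends to a family
`S(z)`, `z ∈ sector δ ∪ {0}`, that has the semigroup property on the sector, is holomorphic there,
and on every smaller sector is strongly continuous at `0` and bounded. -/
def IsBoundedHolomorphic {E : Type*} [NormedAddCommGroup E] [NormedSpace ℂ E]
    (T : ℝ≥0 → E →L[ℂ] E) (δ : ℝ) : Prop :=
  ∃ S : ℂ → E →L[ℂ] E,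
    (∀ t : ℝ≥0, S ((t : ℝ) : ℂ) = T t) ∧
    (∀ z₁ ∈ sector δ, ∀ z₂ ∈ sector δ, S (z₁ + z₂) = (S z₁).comp (S z₂)) ∧
    DifferentiableOn ℂ S (sector δ) ∧
    ∀ δ' : ℝ, 0 < δ' → δ' < δ →
      (∀ x, Tendsto (fun z => S z x) (𝓝[sector δ'] 0) (𝓝 x)) ∧
      ∃ K : ℝ, ∀ z ∈ sector δ', ‖S z‖ ≤ K

end PadicNonlocal

end

open PadicNonlocal

/-! Conjugated by the Fourier transform, a translation-invariant operator becomes a multiplication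
operator; here the multiplier is `-κ A_w`. Once `A_w` is known to be real, nonnegative and
measurable and the Fourier transform to be unitary, all statements in `L²` are statements about
multiplication by one function `a = κ A_w ≥ 0`.

Arithmetic side. The growth exponent exceeds `n`, so `1/w` is integrable off every ball around `0`.
Test functions are constant on the cosets of some ball, and characters are trivial on the dual ball,
so the numerators vanish near `y = 0` and `1/w` may be replaced by the integrable kernel
`cutoffInv`. Absolute convergence, integrability of `W φ` and the Fubini argument in
`nonlocalOp_eq_invFourierIntegral` follow. Orthogonality of characters on balls
(`setIntegral_closedBall_Psi`) gives radiality of `A_w`, hence its realness through `ξ ↦ -ξ`, and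
also Fourier inversion; Parseval and density of test functions then yield the unitary `fourierL2`.

Operator side. For measurable `a ≥ 0` the maximal multiplication operator is self-adjoint because
the bounded multipliers `(1 + a)⁻¹` and `a (1 + a)⁻¹` detect its graph (`mulRel_of_resolvent`). The
semigroup is multiplication by `exp (-z a)`, a contraction for `Re z ≥ 0` and holomorphic in
operator norm for `Re z > 0`. -/

noncomputable section
namespace PadicNonlocal

/-! ### The additive character of `ℚ_p` -/

section Character

variable {p : ℕ} [Fact p.Prime]

/-- Truncating the integer `p ^ k * x` modulo `p ^ k` leaves an error in `p ^ k ℤ_p`; dividing by `p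
^ k` leaves one in `ℤ_p`. -/
theorem norm_sub_fracPart_le_one (x : ℚ_[p]) : ‖x - ((fracPart x : ℚ) : ℚ_[p])‖ ≤ 1 := by
  set k := (-x.valuation).toNat with hk
  set u : ℤ_[p] := ⟨(p : ℚ_[p]) ^ k * x, norm_pow_mul_le_one x⟩ with hu
  have hp0 : (p : ℚ_[p]) ≠ 0 := by exact_mod_cast (Fact.out : p.Prime).ne_zero
  obtain ⟨c, hc⟩ := Ideal.mem_span_singleton'.1 (PadicInt.appr_spec k u)
  have h1 : (p : ℚ_[p]) ^ k * x - (u.appr k : ℚ_[p]) = c * (p : ℚ_[p]) ^ k := by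
    have := congrArg (fun z : ℤ_[p] => (z : ℚ_[p])) hc
    push_cast at this
    rw [this]
  have h2 : x - ((fracPart x : ℚ) : ℚ_[p]) = c := by
    have h3 : ((fracPart x : ℚ) : ℚ_[p]) = (u.appr k : ℚ_[p]) / (p : ℚ_[p]) ^ k := by
      simp only [fracPart]
      push_cast
      rfl
    rw [h3]
    field_simp
    linear_combination h1
  rw [h2]
  exact c.2

theorem exists_fracPart_eq (x : ℚ_[p]) : ∃ (a : ℤ) (k : ℕ), fracPart x = a / (p : ℚ) ^ k :=
  ⟨(PadicInt.appr (⟨(p : ℚ_[p]) ^ (-x.valuation).toNat * x, norm_pow_mul_le_one x⟩ : ℤ_[p])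
    (-x.valuation).toNat : ℕ), _, by simp only [fracPart]; push_cast; rfl⟩

/-- This is `ℤ[1/p] ∩ ℤ_p = ℤ`: the norm bound forces `p ^ k ∣ a`. It makes the choice of
representative irrelevant in the exponential. -/
theorem exists_int_of_norm_div_le_one {a : ℤ} {k : ℕ}
    (h : ‖(((a : ℚ) / (p : ℚ) ^ k : ℚ) : ℚ_[p])‖ ≤ 1) : ∃ m : ℤ, (a : ℚ) / (p : ℚ) ^ k = m := by
  have hp0 : (p : ℚ) ≠ 0 := by exact_mod_cast (Fact.out : p.Prime).ne_zero
  have hpR : (0 : ℝ) < p := by exact_mod_cast (Fact.out : p.Prime).pos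
  have h1 : ‖(a : ℚ_[p])‖ ≤ (p : ℝ) ^ (-(k : ℤ)) := by
    push_cast at h
    rw [norm_div, norm_pow, Padic.norm_p, inv_pow, div_inv_eq_mul] at h
    rw [zpow_neg, zpow_natCast, ← one_div]
    rwa [le_div_iff₀ (by positivity)]
  obtain ⟨m, rfl⟩ := (Padic.norm_int_le_pow_iff_dvd a k).1 h1
  refine ⟨m, ?_⟩
  push_cast
  field_simp

/-- The character can be computed from any representative modulo `ℤ_p` in `ℤ[1/p]`. -/
theorem Psi_eq_of_norm_sub_le {x : ℚ_[p]} {a : ℤ} {k : ℕ}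
    (h : ‖x - (((a : ℚ) / (p : ℚ) ^ k : ℚ) : ℚ_[p])‖ ≤ 1) :
    Psi x = Complex.exp (2 * Real.pi * Complex.I * (((a : ℚ) / (p : ℚ) ^ k : ℚ) : ℂ)) := by
  have hp0 : (p : ℚ) ≠ 0 := by exact_mod_cast (Fact.out : p.Prime).ne_zero
  obtain ⟨b, l, hb⟩ := exists_fracPart_eq x
  have h1 := norm_sub_fracPart_le_one x
  have h2 : ((b : ℚ) / (p : ℚ) ^ l - (a : ℚ) / (p : ℚ) ^ k)
      = ((b * p ^ k - a * p ^ l : ℤ) : ℚ) / (p : ℚ) ^ (l + k) := by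
    push_cast
    rw [pow_add]
    field_simp
  have h3 : ‖((((b * p ^ k - a * p ^ l : ℤ) : ℚ) / (p : ℚ) ^ (l + k) : ℚ) : ℚ_[p])‖ ≤ 1 := by
    rw [← h2]
    have : (((b : ℚ) / (p : ℚ) ^ l - (a : ℚ) / (p : ℚ) ^ k : ℚ) : ℚ_[p])
        = (x - (((a : ℚ) / (p : ℚ) ^ k : ℚ) : ℚ_[p])) - (x - ((fracPart x : ℚ) : ℚ_[p])) := by
      rw [hb, Rat.cast_sub]; ring
    rw [this]
    rw [sub_eq_add_neg]
    exact (IsUltrametricDist.norm_add_le_max _ _).trans (max_le h (by rwa [norm_neg]))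
  obtain ⟨m, hm⟩ := exists_int_of_norm_div_le_one h3
  rw [← h2] at hm
  have h4 : fracPart x = (a : ℚ) / (p : ℚ) ^ k + m := by rw [hb, ← hm]; ring
  rw [Psi, h4, Complex.exp_eq_exp_iff_exists_int]
  exact ⟨m, by push_cast; ring⟩

theorem Psi_add (x y : ℚ_[p]) : Psi (x + y) = Psi x * Psi y := by
  have hp0 : (p : ℚ) ≠ 0 := by exact_mod_cast (Fact.out : p.Prime).ne_zero
  obtain ⟨a, k, ha⟩ := exists_fracPart_eq x
  -- The fractional part is not additive, but the sum of the two fractional parts is a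
  -- representative of `x + y` in `ℤ[1/p]` modulo `ℤ_p`, which is enough.
  obtain ⟨b, l, hb⟩ := exists_fracPart_eq y
  have h2 : ((a : ℚ) / (p : ℚ) ^ k + (b : ℚ) / (p : ℚ) ^ l)
      = ((a * p ^ l + b * p ^ k : ℤ) : ℚ) / (p : ℚ) ^ (k + l) := by
    push_cast
    rw [pow_add]
    field_simp
  have h3 : ‖(x + y) - ((((a * p ^ l + b * p ^ k : ℤ) : ℚ) / (p : ℚ) ^ (k + l) : ℚ) : ℚ_[p])‖
      ≤ 1 := by
    rw [← h2, ← ha, ← hb, Rat.cast_add, add_sub_add_comm]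
    exact (IsUltrametricDist.norm_add_le_max _ _).trans
      (max_le (norm_sub_fracPart_le_one x) (norm_sub_fracPart_le_one y))
  rw [Psi_eq_of_norm_sub_le h3, ← h2, ← ha, ← hb, Psi, Psi, ← Complex.exp_add]
  congr 1
  push_cast
  ring

theorem Psi_eq_one {x : ℚ_[p]} (hx : ‖x‖ ≤ 1) : Psi x = 1 := by
  rw [Psi_eq_of_norm_sub_le (a := 0) (k := 0) (by simpa using hx)]
  simp

@[simp] theorem Psi_zero : Psi (0 : ℚ_[p]) = 1 := Psi_eq_one (by simp)

@[simp] theorem norm_Psi (x : ℚ_[p]) : ‖Psi x‖ = 1 := by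
  rw [Psi, show (2 * Real.pi * Complex.I * (fracPart x : ℂ))
    = ((2 * Real.pi * (fracPart x : ℝ) : ℝ) : ℂ) * Complex.I by push_cast; ring]
  exact Complex.norm_exp_ofReal_mul_I _

theorem Psi_neg (x : ℚ_[p]) : Psi (-x) = starRingEnd ℂ (Psi x) := by
  have h : Psi x * Psi (-x) = 1 := by rw [← Psi_add, add_neg_cancel, Psi_zero]
  have h2 : Psi x * starRingEnd ℂ (Psi x) = 1 := by
    rw [Complex.mul_conj, Complex.normSq_eq_norm_sq, norm_Psi]; simp
  have h3 : Psi x ≠ 0 := by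
    intro h0
    simp [h0] at h
  exact mul_left_cancel₀ h3 (h.trans h2.symm)

theorem Psi_inv_prime_ne_one : Psi ((p : ℚ_[p])⁻¹) ≠ 1 := by
  have hp := (Fact.out : p.Prime)
  have h : ‖(p : ℚ_[p])⁻¹ - ((((1 : ℤ) : ℚ) / (p : ℚ) ^ 1 : ℚ) : ℚ_[p])‖ ≤ 1 := by simp
  rw [Psi_eq_of_norm_sub_le h]
  intro h1
  have := (Complex.isPrimitiveRoot_exp p hp.ne_zero).ne_one hp.one_lt
  apply this
  rw [← h1]
  congr 1
  push_cast
  ring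

theorem continuous_Psi : Continuous (Psi : ℚ_[p] → ℂ) := by
  refine IsLocallyConstant.continuous ((IsLocallyConstant.iff_exists_open _).2 fun x => ?_)
  refine ⟨Metric.ball x 1, Metric.isOpen_ball, Metric.mem_ball_self one_pos, fun y hy => ?_⟩
  rw [Metric.mem_ball, dist_eq_norm] at hy
  rw [← sub_add_cancel y x, Psi_add, Psi_eq_one hy.le, one_mul]

end Character

/-! ### The pairing and duality of balls -/

section Dot

variable {p : ℕ} [Fact p.Prime] {n : ℕ}

theorem dot_add (ξ x y : Qpn p n) : dot ξ (x + y) = dot ξ x + dot ξ y := by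
  simp [dot, mul_add, Finset.sum_add_distrib]

theorem dot_comm (ξ x : Qpn p n) : dot ξ x = dot x ξ := by
  simp [dot, mul_comm]

theorem dot_neg (ξ x : Qpn p n) : dot ξ (-x) = -dot ξ x := by simp [dot]

theorem neg_dot (ξ x : Qpn p n) : dot (-ξ) x = -dot ξ x := by simp [dot]

theorem dot_sub (ξ x y : Qpn p n) : dot ξ (x - y) = dot ξ x - dot ξ y := by
  rw [sub_eq_add_neg, dot_add, dot_neg, ← sub_eq_add_neg]

theorem norm_dot_le (ξ x : Qpn p n) : ‖dot ξ x‖ ≤ ‖ξ‖ * ‖x‖ := by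
  refine IsUltrametricDist.norm_sum_le_of_forall_le_of_nonneg (by positivity) fun i _ => ?_
  rw [norm_mul]
  gcongr
  · exact norm_le_pi_norm ξ i
  · exact norm_le_pi_norm x i

theorem continuous_dot : Continuous fun z : Qpn p n × Qpn p n => dot z.1 z.2 := by
  unfold dot
  fun_prop

theorem continuous_Psi_dot : Continuous fun z : Qpn p n × Qpn p n => Psi (dot z.1 z.2) :=
  continuous_Psi.comp continuous_dot

theorem continuous_Psi_dot_left (ξ : Qpn p n) : Continuous fun x => Psi (dot ξ x) :=
  continuous_Psi.comp (by unfold dot; fun_prop)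

theorem Psi_dot_eq_one {ξ x : Qpn p n} {k : ℤ} (hξ : ‖ξ‖ ≤ (p : ℝ) ^ (-k))
    (hx : ‖x‖ ≤ (p : ℝ) ^ k) : Psi (dot ξ x) = 1 := by
  have hpR : (0 : ℝ) < p := by exact_mod_cast (Fact.out : p.Prime).pos
  refine Psi_eq_one ((norm_dot_le ξ x).trans ?_)
  calc ‖ξ‖ * ‖x‖ ≤ (p : ℝ) ^ (-k) * (p : ℝ) ^ k := by gcongr
    _ = 1 := by rw [← zpow_add₀ hpR.ne']; simp

theorem exists_norm_eq_zpow {x : Qpn p n} (hx : x ≠ 0) :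
    ∃ (i : Fin n) (k : ℤ), ‖x‖ = ‖x i‖ ∧ ‖x‖ = (p : ℝ) ^ k := by
  have : Nonempty (Fin n) := by
    by_contra h
    rw [not_nonempty_iff] at h
    exact hx (Subsingleton.elim _ _)
  obtain ⟨i, -, hi'⟩ := Finset.exists_mem_eq_sup Finset.univ Finset.univ_nonempty
    fun i => ‖x i‖₊
  have hi : ‖x i‖ = ‖x‖ := by rw [Pi.norm_def, hi', coe_nnnorm]
  have h0 : x i ≠ 0 := by
    intro h
    rw [h, norm_zero] at hi
    exact hx (norm_eq_zero.1 hi.symm)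
  exact ⟨i, -(x i).valuation, hi.symm, by rw [← hi, Padic.norm_eq_zpow_neg_valuation h0]⟩

theorem exists_Psi_dot_ne_one {ξ : Qpn p n} {k : ℤ} (hξ : (p : ℝ) ^ (-k) < ‖ξ‖) :
    ∃ x : Qpn p n, ‖x‖ ≤ (p : ℝ) ^ k ∧ Psi (dot ξ x) ≠ 1 := by
  have hp1 : (1 : ℝ) < p := by exact_mod_cast (Fact.out : p.Prime).one_lt
  have hpR : (0 : ℝ) < p := by positivity
  have h0 : ξ ≠ 0 := by
    rintro rfl
    rw [norm_zero] at hξ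
    exact absurd hξ (not_lt.2 (by positivity))
  obtain ⟨i, l, hi, hl⟩ := exists_norm_eq_zpow h0
  have hi0 : ξ i ≠ 0 := by
    intro h
    rw [h, norm_zero, norm_eq_zero] at hi
    exact h0 hi
  -- Supported on a coordinate where `ξ` attains its norm, this vector pairs with `ξ` to `p⁻¹`. Its
  -- norm is `p / ‖ξ‖`, at most `p ^ k` because norms are integral powers of `p`, so `‖ξ‖ ≥ p ^ (1 -
  -- k)`.
  refine ⟨Pi.single i ((p : ℚ_[p])⁻¹ / ξ i), ?_, ?_⟩
  · rw [Pi.norm_single, norm_div, norm_inv, Padic.norm_p, inv_inv, ← hi, hl]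
    rw [hl, zpow_lt_zpow_iff_right₀ hp1] at hξ
    rw [div_eq_mul_inv, ← zpow_neg, ← zpow_one_add₀ hpR.ne']
    exact zpow_le_zpow_right₀ hp1.le (by omega)
  · have : dot ξ (Pi.single i ((p : ℚ_[p])⁻¹ / ξ i)) = (p : ℚ_[p])⁻¹ := by
      rw [dot, Finset.sum_eq_single i]
      · simp; field_simp
      · intro j _ hj; simp [hj]
      · simp
    rw [this]
    exact Psi_inv_prime_ne_one

end Dot

/-! ### Volumes of balls -/

section Haar

variable (p : ℕ) [Fact p.Prime] (n : ℕ)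

instance isAddHaarMeasure_haar : (haar p n).IsAddHaarMeasure := by unfold haar; infer_instance

instance regular_haar : (haar p n).Regular := by unfold haar; infer_instance

theorem prime_pos_real : (0 : ℝ) < p := by exact_mod_cast (Fact.out : p.Prime).pos

theorem one_lt_prime_real : (1 : ℝ) < p := by exact_mod_cast (Fact.out : p.Prime).one_lt

/-- The volume of the ball of radius `p ^ k`. -/
def ballVol (k : ℤ) : ℝ := (haar p n).real (Metric.closedBall 0 ((p : ℝ) ^ k))

theorem haar_ball_zero : haar p n (Metric.closedBall 0 1) = 1 :=
  Measure.addHaarMeasure_self (K₀ := unitBall p n)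

theorem haar_real_closedBall (x : Qpn p n) (k : ℤ) :
    (haar p n).real (Metric.closedBall x ((p : ℝ) ^ k)) = ballVol p n k := by
  rw [ballVol, Measure.real, Measure.real, Measure.addHaar_closedBall_center]

open scoped Pointwise in
-- The constant is the modulus of scaling by `p⁻¹`. Its exact value is never needed: inversion uses
-- multiplicativity only, and convergence at infinity only the bound `c ≤ p ^ n`.
theorem exists_ballVol_eq_zpow : ∃ c : ℝ, 0 < c ∧ ∀ k : ℤ, ballVol p n k = c ^ k := by
  have hp0 : (p : ℚ_[p]) ≠ 0 := by exact_mod_cast (Fact.out : p.Prime).ne_zero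
  have hpR := prime_pos_real p
  set u : ℚ_[p]ˣ := Units.mk0 (p : ℚ_[p]) hp0 with hu
  refine ⟨(distribHaarChar (Qpn p n) u⁻¹ : ℝ), by exact_mod_cast distribHaarChar_pos, fun k => ?_⟩
  have h1 := distribHaarChar_mul (haar p n) (u⁻¹ ^ k) (Metric.closedBall 0 1)
  rw [haar_ball_zero, mul_one, map_zpow] at h1
  have h2 : (u⁻¹ ^ k) • (Metric.closedBall (0 : Qpn p n) 1) =
      Metric.closedBall 0 ((p : ℝ) ^ k) := by
    ext x
    rw [Set.mem_smul_set_iff_inv_smul_mem, mem_closedBall_zero_iff, mem_closedBall_zero_iff,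
      inv_zpow, inv_inv, Units.smul_def, norm_smul, Units.val_zpow_eq_zpow_val, hu, Units.val_mk0,
      norm_zpow, Padic.norm_p, inv_zpow, inv_mul_le_iff₀ (by positivity), mul_one]
  rw [h2] at h1
  rw [ballVol, Measure.real, ← h1]
  simp

theorem ballVol_mul_ballVol_neg (k : ℤ) : ballVol p n k * ballVol p n (-k) = 1 := by
  obtain ⟨c, hc, h⟩ := exists_ballVol_eq_zpow p n
  rw [h, h, ← zpow_add₀ hc.ne']
  simp

/-- The centres come from the residues modulo `p` of the integers `p * x i`; there are `p ^ n` of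
them, which bounds the modulus of scaling. -/
theorem closedBall_one_subset : Metric.closedBall (0 : Qpn p n) p ⊆
    ⋃ a : Fin n → Fin p, Metric.closedBall (fun i => ((a i : ℕ) : ℚ_[p]) / p) 1 := by
  have hp0 : (p : ℚ_[p]) ≠ 0 := by exact_mod_cast (Fact.out : p.Prime).ne_zero
  have hpR := prime_pos_real p
  intro x hx
  rw [mem_closedBall_zero_iff] at hx
  have key : ∀ i, ∃ m : Fin p, ‖x i - ((m : ℕ) : ℚ_[p]) / p‖ ≤ 1 := by
    intro i
    have h1 : ‖(p : ℚ_[p]) * x i‖ ≤ 1 := by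
      rw [norm_mul, Padic.norm_p, inv_mul_le_iff₀ hpR, mul_one]
      exact (norm_le_pi_norm x i).trans hx
    obtain ⟨u, hu⟩ : ∃ u : ℤ_[p], (u : ℚ_[p]) = p * x i := ⟨⟨_, h1⟩, rfl⟩
    obtain ⟨m, hm, hmem⟩ := PadicInt.exists_mem_range u
    refine ⟨⟨m, hm⟩, ?_⟩
    rw [PadicInt.maximalIdeal_eq_span_p, Ideal.mem_span_singleton'] at hmem
    obtain ⟨c, hc⟩ := hmem
    have h2 := congrArg (fun z : ℤ_[p] => (z : ℚ_[p])) hc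
    push_cast at h2
    rw [hu] at h2
    have h3 : x i - (m : ℚ_[p]) / p = c := by
      field_simp
      linear_combination -h2
    simp only [h3]
    exact c.2
  choose a ha using key
  refine Set.mem_iUnion.2 ⟨a, ?_⟩
  rw [Metric.mem_closedBall, dist_eq_norm, pi_norm_le_iff_of_nonneg zero_le_one]
  exact ha

theorem ballVol_le {k : ℤ} (hk : 0 ≤ k) : ballVol p n k ≤ ((p : ℝ) ^ n) ^ k := by
  obtain ⟨c, hc, h⟩ := exists_ballVol_eq_zpow p n
  have h1 : c ≤ (p : ℝ) ^ n := by
    rw [← zpow_one c, ← h, ballVol, zpow_one]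
    calc (haar p n).real (Metric.closedBall 0 p) ≤ (haar p n).real
          (⋃ a : Fin n → Fin p, Metric.closedBall (fun i => ((a i : ℕ) : ℚ_[p]) / p) 1) :=
          measureReal_mono (closedBall_one_subset p n)
            
            ((measure_iUnion_fintype_le _ _).trans_lt
              (ENNReal.sum_lt_top.2 fun _ _ => measure_closedBall_lt_top)).ne
      _ ≤ ∑ a : Fin n → Fin p, (haar p n).real
            (Metric.closedBall (fun i => ((a i : ℕ) : ℚ_[p]) / p) 1) :=
          measureReal_iUnion_fintype_le _
      _ = (p : ℝ) ^ n := by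
          have : ∀ x : Qpn p n, (haar p n).real (Metric.closedBall x 1) = 1 := fun x => by
            rw [Measure.real, Measure.addHaar_closedBall_center, haar_ball_zero]; simp
          simp [this]
  lift k to ℕ using hk
  rw [h, zpow_natCast, zpow_natCast]
  gcongr

end Haar

/-! ### Orthogonality of characters on balls -/

section BallIntegral

variable {p : ℕ} [Fact p.Prime] {n : ℕ}

theorem add_mem_closedBall_iff {x z : Qpn p n} {r : ℝ} (hz : ‖z‖ ≤ r) :
    x + z ∈ Metric.closedBall (0 : Qpn p n) r ↔ x ∈ Metric.closedBall (0 : Qpn p n) r := by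
  simp only [mem_closedBall_zero_iff]
  refine ⟨fun h => ?_, fun h => (IsUltrametricDist.norm_add_le_max _ _).trans (max_le h hz)⟩
  rw [← add_neg_cancel_right x z]
  exact (IsUltrametricDist.norm_add_le_max _ _).trans (max_le h (by rwa [norm_neg]))

theorem setIntegral_closedBall_Psi (ξ : Qpn p n) (k : ℤ) :
    ∫ x in Metric.closedBall 0 ((p : ℝ) ^ k), Psi (dot ξ x) ∂(haar p n) =
      if ‖ξ‖ ≤ (p : ℝ) ^ (-k) then (ballVol p n k : ℂ) else 0 := by
  split_ifs with hξ
  · rw [setIntegral_congr_fun (g := fun _ => (1 : ℂ)) Metric.isClosed_closedBall.measurableSet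
      fun x hx => Psi_dot_eq_one hξ (mem_closedBall_zero_iff.1 hx)]
    simp [ballVol]
  -- The ball is a group, so translating by `z` multiplies the integral by `Psi (dot ξ z) ≠ 1`
  -- without changing it; it must vanish.
  · obtain ⟨z, hz, hne⟩ := exists_Psi_dot_ne_one (not_le.1 hξ)
    rw [← integral_indicator Metric.isClosed_closedBall.measurableSet]
    set F := (Metric.closedBall (0 : Qpn p n) ((p : ℝ) ^ k)).indicator fun x => Psi (dot ξ x)
      with hF
    have h1 : ∀ x, F (x + z) = Psi (dot ξ z) * F x := by
      intro x
      by_cases hx : x ∈ Metric.closedBall (0 : Qpn p n) ((p : ℝ) ^ k)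
      · rw [hF, Set.indicator_of_mem hx, Set.indicator_of_mem ((add_mem_closedBall_iff hz).2 hx),
          dot_add, Psi_add, mul_comm]
      · rw [hF, Set.indicator_of_notMem hx,
          Set.indicator_of_notMem (mt (add_mem_closedBall_iff hz).1 hx), mul_zero]
    have h2 : ∫ x, F x ∂(haar p n) = Psi (dot ξ z) * ∫ x, F x ∂(haar p n) := by
      rw [← integral_const_mul, ← integral_add_right_eq_self F z]
      simp only [h1]
    have h3 : (1 - Psi (dot ξ z)) * ∫ x, F x ∂(haar p n) = 0 := by
      rw [sub_mul, one_mul, ← h2, sub_self]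
    exact (mul_eq_zero.1 h3).resolve_left (sub_ne_zero.2 (Ne.symm hne))

end BallIntegral

/-! ### Integrability of the kernel and the symbol `A_w` -/

section Symbol

variable {p : ℕ} [Fact p.Prime] {n : ℕ} {w : Qpn p n → ℝ}

theorem exists_zpow_ge (p : ℕ) [Fact p.Prime] (r : ℝ) : ∃ m : ℤ, r ≤ (p : ℝ) ^ m := by
  obtain ⟨k, hk⟩ := pow_unbounded_of_one_lt r (one_lt_prime_real p)
  exact ⟨k, by rw [zpow_natCast]; exact hk.le⟩

theorem IsAdmissible.ne_zero (hw : IsAdmissible w) {y : Qpn p n} (hy : y ≠ 0) : w y ≠ 0 :=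
  mt (hw.eq_zero_iff y).1 hy

theorem IsAdmissible.continuousOn_inv (hw : IsAdmissible w) :
    ContinuousOn (fun y => (w y)⁻¹) {y | y ≠ 0} :=
  hw.continuous.continuousOn.inv₀ fun _ hy => hw.ne_zero hy

theorem IsAdmissible.integrableOn_inv_annulus (hw : IsAdmissible w) {r R : ℝ} (hr : 0 < r) :
    IntegrableOn (fun y => (w y)⁻¹) (Metric.closedBall 0 R ∩ {y | r ≤ ‖y‖}) (haar p n) := by
  refine ContinuousOn.integrableOn_compact ?_ ?_
  · exact (isCompact_closedBall _ _).inter_right (isClosed_le continuous_const continuous_norm)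
  · refine hw.continuousOn_inv.mono fun y hy => ?_
    rintro rfl
    have : r ≤ ‖(0 : Qpn p n)‖ := hy.2
    rw [norm_zero] at this
    exact absurd this (not_le.2 hr)

/-- Summation over shells: outside radius `p ^ j` the growth bound gives `1/w ≤ C₀⁻¹ p ^ (-α j)`,
the shell has volume at most `p ^ (n (j + 1))`, and the ratio `p ^ (n - α)` is below `1`. -/
theorem IsAdmissible.exists_integrableOn_inv_compl_ball (hw : IsAdmissible w) :
    ∃ K : ℕ, IntegrableOn (fun y => (w y)⁻¹) {y | (p : ℝ) ^ K < ‖y‖} (haar p n) := by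
  have hp1 := one_lt_prime_real p
  have hpR := prime_pos_real p
  obtain ⟨C₀, M, α, hC, hα, hgrow⟩ := hw.growth
  -- A negative `M` is replaced by `0`, so that only radii at least `1` occur, where the volume
  -- bound `ballVol_le` is available.
  set K := M.toNat
  refine ⟨K, ?_⟩
  set S : ℕ → Set (Qpn p n) := fun k =>
    Metric.closedBall 0 ((p : ℝ) ^ (k + K + 1)) \ Metric.closedBall 0 ((p : ℝ) ^ (k + K)) with hS
  have hcover : {y : Qpn p n | (p : ℝ) ^ K < ‖y‖} ⊆ ⋃ k, S k := by
    intro y hy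
    have hy' : (p : ℝ) ^ K < ‖y‖ := hy
    obtain ⟨i, l, -, hl⟩ := exists_norm_eq_zpow
      (norm_pos_iff.1 ((by positivity : (0 : ℝ) < (p : ℝ) ^ K).trans hy'))
    rw [hl, ← zpow_natCast, zpow_lt_zpow_iff_right₀ hp1] at hy'
    obtain ⟨k, rfl⟩ : ∃ k : ℕ, l = ((k + K + 1 : ℕ) : ℤ) := ⟨(l - K - 1).toNat, by omega⟩
    rw [zpow_natCast] at hl
    refine Set.mem_iUnion.2 ⟨k, ?_⟩
    simp only [hS, Set.mem_sdiff, mem_closedBall_zero_iff, hl, not_le, le_refl, true_and]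
    exact pow_lt_pow_right₀ hp1 (by omega)
  have hmeas : ∀ k, MeasurableSet (S k) := fun k =>
    Metric.isClosed_closedBall.measurableSet.diff Metric.isClosed_closedBall.measurableSet
  have hint : ∀ k, IntegrableOn (fun y => (w y)⁻¹) (S k) (haar p n) := fun k =>
    (hw.integrableOn_inv_annulus (r := (p : ℝ) ^ (k + K)) (R := (p : ℝ) ^ (k + K + 1))
      (by positivity)).mono_set fun y hy =>
        ⟨hy.1, (not_le.1 (mt mem_closedBall_zero_iff.2 hy.2)).le⟩
  refine (integrableOn_iUnion_of_summable_integral_norm hint ?_).mono_set hcover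
  set q : ℝ := (p : ℝ) ^ n * ((p : ℝ) ^ α)⁻¹ with hq
  have hq0 : 0 ≤ q := by positivity
  have hq1 : q < 1 := by
    rw [hq, ← Real.rpow_natCast, ← div_eq_mul_inv, div_lt_one (by positivity)]
    exact Real.rpow_lt_rpow_of_exponent_lt hp1 hα
  have hsum : Summable fun k : ℕ => C₀⁻¹ * (p : ℝ) ^ n * q ^ (k + K) :=
    ((summable_nat_add_iff K).2 (summable_geometric_of_lt_one hq0 hq1)).mul_left _
  refine Summable.of_nonneg_of_le (fun k => integral_nonneg fun _ => norm_nonneg _) (fun k => ?_)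
    hsum
  set j := k + K with hj
  have hbound : ∀ y ∈ S k, ‖‖(w y)⁻¹‖‖ ≤ (C₀ * ((p : ℝ) ^ α) ^ j)⁻¹ := by
    intro y hy
    have hy2 : (p : ℝ) ^ j < ‖y‖ := not_le.1 (mt mem_closedBall_zero_iff.2 hy.2)
    have hyM : (p : ℝ) ^ M ≤ ‖y‖ := by
      refine le_trans ?_ hy2.le
      rw [← zpow_natCast]
      exact zpow_le_zpow_right₀ hp1.le (by omega)
    rw [norm_norm, norm_inv, Real.norm_of_nonneg (hw.nonneg y)]
    refine inv_anti₀ (by positivity) (le_trans ?_ (hgrow y hyM))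
    rw [Real.rpow_pow_comm hpR.le]
    gcongr
    exact (Nat.cast_nonneg n).trans hα.le
  have hvol : (haar p n).real (S k) ≤ (p : ℝ) ^ n * ((p : ℝ) ^ n) ^ j := by
    have h1 := ballVol_le p n (k := ((j + 1 : ℕ) : ℤ)) (by positivity)
    rw [ballVol, zpow_natCast, zpow_natCast, pow_succ' ((p : ℝ) ^ n)] at h1
    exact (measureReal_mono Set.sdiff_subset measure_closedBall_lt_top.ne).trans h1
  calc ∫ y in S k, ‖(w y)⁻¹‖ ∂(haar p n) ≤ ‖∫ y in S k, ‖(w y)⁻¹‖ ∂(haar p n)‖ := le_abs_self _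
    _ ≤ (C₀ * ((p : ℝ) ^ α) ^ j)⁻¹ * (haar p n).real (S k) :=
      norm_setIntegral_le_of_norm_le_const
        ((measure_mono Set.sdiff_subset).trans_lt measure_closedBall_lt_top) hbound
    _ ≤ (C₀ * ((p : ℝ) ^ α) ^ j)⁻¹ * ((p : ℝ) ^ n * ((p : ℝ) ^ n) ^ j) := by gcongr
    _ = C₀⁻¹ * (p : ℝ) ^ n * q ^ j := by rw [hq, mul_pow, mul_inv, inv_pow]; ring

/-- The function `1 / w`, cut off on the ball of radius `p ^ m`. -/
def cutoffInv (w : Qpn p n → ℝ) (m : ℤ) (y : Qpn p n) : ℝ :=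
  {y | (p : ℝ) ^ m < ‖y‖}.indicator (fun y => (w y)⁻¹) y

theorem cutoffInv_nonneg (hw : IsAdmissible w) (m : ℤ) (y : Qpn p n) : 0 ≤ cutoffInv w m y :=
  Set.indicator_nonneg (fun y _ => inv_nonneg.2 (hw.nonneg y)) y

theorem integrable_cutoffInv (hw : IsAdmissible w) (m : ℤ) :
    Integrable (cutoffInv w m) (haar p n) := by
  have hpR := prime_pos_real p
  obtain ⟨K, hK⟩ := hw.exists_integrableOn_inv_compl_ball
  have h := (hw.integrableOn_inv_annulus (r := (p : ℝ) ^ m) (R := (p : ℝ) ^ K)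
    (by positivity)).union hK
  refine (integrable_indicator_iff
    (isOpen_lt continuous_const continuous_norm).measurableSet).2 (h.mono_set fun y hy => ?_)
  have hy' : (p : ℝ) ^ m < ‖y‖ := hy
  rcases le_or_gt ‖y‖ ((p : ℝ) ^ K) with h1 | h1
  · exact Or.inl ⟨mem_closedBall_zero_iff.2 h1, hy'.le⟩
  · exact Or.inr h1

theorem integrable_cutoffInv_ofReal (hw : IsAdmissible w) (m : ℤ) :
    Integrable (fun y => (cutoffInv w m y : ℂ)) (haar p n) :=
  (integrable_cutoffInv hw m).ofReal

/-- Removes the singularity at `0`: where `w` is small the numerator is already zero, so the default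
value of division by `w 0 = 0` plays no role. -/
theorem div_eq_mul_cutoffInv {g : Qpn p n → ℂ} {m : ℤ}
    (hg : ∀ y, ‖y‖ ≤ (p : ℝ) ^ m → g y = 0) (y : Qpn p n) :
    g y / (w y : ℂ) = g y * (cutoffInv w m y : ℂ) := by
  rcases le_or_gt ‖y‖ ((p : ℝ) ^ m) with h | h
  · simp [hg y h]
  · rw [cutoffInv, Set.indicator_of_mem (by exact h), div_eq_mul_inv, Complex.ofReal_inv]

theorem integrable_mul_cutoffInv (hw : IsAdmissible w) (m : ℤ) {g : Qpn p n → ℂ} {C : ℝ}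
    (hgm : AEStronglyMeasurable g (haar p n)) (hC : ∀ y, ‖g y‖ ≤ C) :
    Integrable (fun y => g y * (cutoffInv w m y : ℂ)) (haar p n) :=
  (integrable_cutoffInv_ofReal hw m).bdd_mul hgm (Eventually.of_forall hC)

theorem norm_integral_mul_cutoffInv_le (hw : IsAdmissible w) (m : ℤ) {g : Qpn p n → ℂ} {C : ℝ}
    (hC : ∀ y, ‖g y‖ ≤ C) :
    ‖∫ y, g y * (cutoffInv w m y : ℂ) ∂(haar p n)‖ ≤
      C * ∫ y, cutoffInv w m y ∂(haar p n) := by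
  rw [← integral_const_mul]
  refine norm_integral_le_of_norm_le ((integrable_cutoffInv hw m).const_mul C)
    (Eventually.of_forall fun y => ?_)
  rw [norm_mul, Complex.norm_real, Real.norm_of_nonneg (cutoffInv_nonneg hw m y)]
  gcongr
  · exact cutoffInv_nonneg hw m y
  · exact hC y

theorem norm_one_sub_Psi_le (x : ℚ_[p]) : ‖1 - Psi x‖ ≤ 2 :=
  (norm_sub_le _ _).trans (by rw [norm_one, norm_Psi]; norm_num)

theorem continuous_one_sub_Psi_dot (ξ : Qpn p n) : Continuous fun y => 1 - Psi (-dot y ξ) :=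
  continuous_const.sub (continuous_Psi.comp (by unfold dot; fun_prop))

theorem one_sub_Psi_dot_eq_zero {ξ : Qpn p n} {m : ℤ} (hξ : ‖ξ‖ ≤ (p : ℝ) ^ (-m)) (y : Qpn p n)
    (hy : ‖y‖ ≤ (p : ℝ) ^ m) : 1 - Psi (-dot y ξ) = 0 := by
  rw [dot_comm, ← neg_dot, Psi_dot_eq_one (by rwa [norm_neg]) hy, sub_self]

theorem symbolA_eq_integral_cutoffInv {ξ : Qpn p n} {m : ℤ} (hξ : ‖ξ‖ ≤ (p : ℝ) ^ (-m)) :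
    symbolA w ξ = ∫ y, (1 - Psi (-dot y ξ)) * (cutoffInv w m y : ℂ) ∂(haar p n) :=
  integral_congr_ae (Eventually.of_forall (div_eq_mul_cutoffInv (one_sub_Psi_dot_eq_zero hξ)))

theorem integrable_symbolA (hw : IsAdmissible w) (ξ : Qpn p n) :
    Integrable (fun y => (1 - Psi (-dot y ξ)) / (w y : ℂ)) (haar p n) := by
  obtain ⟨m, hm⟩ := exists_zpow_ge p ‖ξ‖
  rw [← neg_neg m] at hm
  simp only [div_eq_mul_cutoffInv (w := w) (one_sub_Psi_dot_eq_zero hm)]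
  exact integrable_mul_cutoffInv hw _ (continuous_one_sub_Psi_dot ξ).aestronglyMeasurable
    fun y => norm_one_sub_Psi_le _

theorem norm_symbolA_le (hw : IsAdmissible w) {ξ : Qpn p n} {m : ℤ}
    (hξ : ‖ξ‖ ≤ (p : ℝ) ^ (-m)) :
    ‖symbolA w ξ‖ ≤ 2 * ∫ y, cutoffInv w m y ∂(haar p n) := by
  rw [symbolA_eq_integral_cutoffInv hξ]
  exact norm_integral_mul_cutoffInv_le hw m fun y => norm_one_sub_Psi_le _

/-- The point of the formula is that its right-hand side involves `ξ` only through `‖ξ‖`. -/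
theorem setIntegral_sphere_one_sub_Psi (ξ : Qpn p n) (k : ℤ) :
    ∫ y in Metric.closedBall 0 ((p : ℝ) ^ k) \ Metric.closedBall 0 ((p : ℝ) ^ (k - 1)),
      (1 - Psi (-dot y ξ)) ∂(haar p n) =
    (ballVol p n k - if ‖ξ‖ ≤ (p : ℝ) ^ (-k) then (ballVol p n k : ℂ) else 0) -
      (ballVol p n (k - 1) -
        if ‖ξ‖ ≤ (p : ℝ) ^ (-(k - 1)) then (ballVol p n (k - 1) : ℂ) else 0) := by
  have hi : ∀ l : ℤ, IntegrableOn (fun y => 1 - Psi (-dot y ξ))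
      (Metric.closedBall 0 ((p : ℝ) ^ l)) (haar p n) := fun l =>
    (continuous_one_sub_Psi_dot ξ).continuousOn.integrableOn_compact (isCompact_closedBall _ _)
  have hb : ∀ l : ℤ, ∫ y in Metric.closedBall 0 ((p : ℝ) ^ l), (1 - Psi (-dot y ξ)) ∂(haar p n) =
      ballVol p n l - if ‖ξ‖ ≤ (p : ℝ) ^ (-l) then (ballVol p n l : ℂ) else 0 := by
    intro l
    rw [integral_sub, ← norm_neg ξ, ← setIntegral_closedBall_Psi]
    · simp only [dot_comm _ ξ, neg_dot]
      simp [ballVol]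
    · exact continuousOn_const.integrableOn_compact (isCompact_closedBall _ _)
    · simp only [dot_comm _ ξ, ← neg_dot]
      exact (continuous_Psi_dot_left _).continuousOn.integrableOn_compact (isCompact_closedBall _ _)
  rw [setIntegral_sdiff Metric.isClosed_closedBall.measurableSet (hi k), hb, hb]
  exact Metric.closedBall_subset_closedBall
    (zpow_le_zpow_right₀ (one_lt_prime_real p).le (by omega))

theorem norm_eq_of_mem_shell {y : Qpn p n} {k : ℤ}
    (hy : y ∈ Metric.closedBall (0 : Qpn p n) ((p : ℝ) ^ k) \
      Metric.closedBall 0 ((p : ℝ) ^ (k - 1))) : ‖y‖ = (p : ℝ) ^ k := by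
  have hp1 := one_lt_prime_real p
  have hpR := prime_pos_real p
  have h1 := mem_closedBall_zero_iff.1 hy.1
  have h2 := not_le.1 (mt mem_closedBall_zero_iff.2 hy.2)
  obtain ⟨i, l, -, hl⟩ := exists_norm_eq_zpow
    (norm_pos_iff.1 ((by positivity : (0 : ℝ) < (p : ℝ) ^ (k - 1)).trans h2))
  rw [hl, zpow_lt_zpow_iff_right₀ hp1] at h2
  rw [hl, zpow_le_zpow_iff_right₀ hp1] at h1
  rw [hl, show l = k by omega]

theorem hasSum_symbolA (hw : IsAdmissible w) (ξ : Qpn p n) :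
    HasSum (fun k : ℤ =>
      ∫ y in Metric.closedBall 0 ((p : ℝ) ^ k) \ Metric.closedBall 0 ((p : ℝ) ^ (k - 1)),
        (1 - Psi (-dot y ξ)) / (w y : ℂ) ∂(haar p n)) (symbolA w ξ) := by
  have hp1 := one_lt_prime_real p
  have h := hasSum_integral_iUnion (μ := haar p n)
    (f := fun y => (1 - Psi (-dot y ξ)) / (w y : ℂ))
    (s := fun k : ℤ => Metric.closedBall (0 : Qpn p n) ((p : ℝ) ^ k) \
      Metric.closedBall 0 ((p : ℝ) ^ (k - 1)))
    (fun k => Metric.isClosed_closedBall.measurableSet.diff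
      Metric.isClosed_closedBall.measurableSet) ?_ (integrable_symbolA hw ξ).integrableOn
  · convert! h using 1
    rw [symbolA, setIntegral_eq_integral_of_forall_compl_eq_zero]
    -- The shells miss only the origin, where the numerator `1 - Psi 0` vanishes.
    intro y hy
    have : y = 0 := by
      by_contra h0
      obtain ⟨i, k, -, hk⟩ := exists_norm_eq_zpow h0
      refine hy (Set.mem_iUnion.2 ⟨k, ?_⟩)
      simp only [Set.mem_sdiff, mem_closedBall_zero_iff, hk, le_refl, not_le, true_and]
      exact zpow_lt_zpow_right₀ hp1 (by omega)
    simp [this, dot]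
  · intro k l hkl
    refine Set.disjoint_left.2 fun y hy hy' => hkl ?_
    have := (norm_eq_of_mem_shell hy).symm.trans (norm_eq_of_mem_shell hy')
    exact zpow_right_injective₀ (by positivity) hp1.ne' this

/-- On each shell `w` is constant and factors out, leaving a character integral that depends on the
norm alone. Summing over shells avoids a change of variables by isometries. -/
theorem symbolA_radial (hw : IsAdmissible w) {ξ η : Qpn p n} (h : ‖ξ‖ = ‖η‖) :
    symbolA w ξ = symbolA w η := by
  refine (hasSum_symbolA hw ξ).unique ?_
  convert hasSum_symbolA hw η using 2 with k
  set S := Metric.closedBall (0 : Qpn p n) ((p : ℝ) ^ k) \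
    Metric.closedBall 0 ((p : ℝ) ^ (k - 1)) with hS
  have hSm : MeasurableSet S := Metric.isClosed_closedBall.measurableSet.diff
    Metric.isClosed_closedBall.measurableSet
  -- Shells are empty when `n = 0`, in which case there is no value of `w` to factor out.
  rcases S.eq_empty_or_nonempty with h0 | ⟨y₀, hy₀⟩
  · simp [h0]
  · have key : ∀ ζ : Qpn p n, ∫ y in S, (1 - Psi (-dot y ζ)) / (w y : ℂ) ∂(haar p n) =
        (∫ y in S, (1 - Psi (-dot y ζ)) ∂(haar p n)) / (w y₀ : ℂ) := by
      intro ζ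
      rw [← integral_div]
      refine setIntegral_congr_fun hSm fun y hy => ?_
      simp only [hw.radial y y₀ ((norm_eq_of_mem_shell hy).trans (norm_eq_of_mem_shell hy₀).symm)]
    rw [key, key, hS, setIntegral_sphere_one_sub_Psi, setIntegral_sphere_one_sub_Psi, h]

/-- Conjugation turns `A_w(ξ)` into `A_w(-ξ)`, which equals `A_w(ξ)` by radiality. -/
theorem symbolA_im (hw : IsAdmissible w) (ξ : Qpn p n) : (symbolA w ξ).im = 0 := by
  have h : starRingEnd ℂ (symbolA w ξ) = symbolA w ξ := by
    refine Eq.trans ?_ (symbolA_radial hw (norm_neg ξ))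
    rw [symbolA, symbolA, ← integral_conj]
    refine integral_congr_ae (Eventually.of_forall fun y => ?_)
    simp [dot_neg, Psi_neg]
  exact Complex.conj_eq_iff_im.1 h

theorem symbolA_re_nonneg (hw : IsAdmissible w) (ξ : Qpn p n) : 0 ≤ (symbolA w ξ).re := by
  have h := integral_re (integrable_symbolA hw ξ)
  change ∫ y, ((1 - Psi (-dot y ξ)) / (w y : ℂ)).re ∂(haar p n) = (symbolA w ξ).re at h
  rw [← h]
  refine integral_nonneg fun y => ?_
  simp only [Complex.div_ofReal_re]
  refine div_nonneg ?_ (hw.nonneg y)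
  rw [Complex.sub_re, Complex.one_re, sub_nonneg]
  exact (Complex.re_le_norm _).trans (norm_Psi _).le

theorem symbolA_eq_ofReal (hw : IsAdmissible w) (ξ : Qpn p n) :
    symbolA w ξ = ((symbolA w ξ).re : ℂ) :=
  Complex.ext (by simp) (by simp [symbolA_im hw])

theorem stronglyMeasurable_symbolA (hw : IsAdmissible w) :
    StronglyMeasurable (symbolA w) := by
  refine StronglyMeasurable.integral_prod_right
    (f := fun ξ y => (1 - Psi (-dot y ξ)) / (w y : ℂ)) (Measurable.stronglyMeasurable ?_)
  have h1 : Continuous fun z : Qpn p n × Qpn p n => Psi (-dot z.2 z.1) :=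
    continuous_Psi.comp (by unfold dot; fun_prop)
  have h2 : Continuous fun z : Qpn p n × Qpn p n => ((w z.2 : ℝ) : ℂ) :=
    Complex.continuous_ofReal.comp (hw.continuous.comp continuous_snd)
  exact (measurable_const.sub h1.measurable).div h2.measurable

end Symbol
end PadicNonlocal
end

/-! ### General integration lemmas -/

noncomputable section

theorem MeasureTheory.Integrable.memLp_of_norm_le {α E : Type*} [MeasurableSpace α]
    [NormedAddCommGroup E] {μ : Measure α} {f : α → E} {C : ℝ} (hf : Integrable f μ)
    (hC : ∀ x, ‖f x‖ ≤ C) {q : ℝ≥0∞} (hq : 1 ≤ q) : MemLp f q μ := by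
  rcases eq_or_ne q ∞ with rfl | hqt
  · exact memLp_top_of_bound hf.aestronglyMeasurable C (Eventually.of_forall hC)
  have hq0 : q ≠ 0 := (zero_lt_one.trans_le hq).ne'
  have hq1 : 1 ≤ q.toReal := by
    rw [← ENNReal.toReal_one]
    exact ENNReal.toReal_mono hqt hq
  rw [← integrable_norm_rpow_iff hf.aestronglyMeasurable hq0 hqt]
  refine (hf.norm.const_mul (C ^ (q.toReal - 1))).mono'
    (hf.aestronglyMeasurable.norm.aemeasurable.pow_const _).aestronglyMeasurable
    (Eventually.of_forall fun x => ?_)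
  rw [Real.norm_of_nonneg (by positivity)]
  -- Interpolation between `L¹` and `L^∞`: all but one power of `‖f x‖` is absorbed by the bound
  -- `C`.
  calc ‖f x‖ ^ q.toReal = ‖f x‖ ^ (q.toReal - 1 + 1) := by rw [sub_add_cancel]
    _ = ‖f x‖ ^ (q.toReal - 1) * ‖f x‖ := by
      rw [Real.rpow_add_of_nonneg (norm_nonneg _) (by linarith) zero_le_one, Real.rpow_one]
    _ ≤ C ^ (q.toReal - 1) * ‖f x‖ := by
      gcongr
      · exact hC x

/-- The multiplication formula for a bounded kernel. -/
theorem MeasureTheory.integral_kernel_mul_comm {α β : Type*} [MeasurableSpace α]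
    [MeasurableSpace β] {μ : Measure α} {ν : Measure β} [SFinite μ] [SFinite ν]
    {k : α → β → ℂ} {C : ℝ} {f : β → ℂ} {g : α → ℂ}
    (hk : AEStronglyMeasurable (Function.uncurry k) (μ.prod ν)) (hC : ∀ x y, ‖k x y‖ ≤ C)
    (hf : Integrable f ν) (hg : Integrable g μ) :
    ∫ x, (∫ y, k x y * f y ∂ν) * g x ∂μ = ∫ y, f y * (∫ x, k x y * g x ∂μ) ∂ν := by
  have h : Integrable (Function.uncurry fun x y => k x y * (g x * f y)) (μ.prod ν) :=
    (hg.mul_prod hf).bdd_mul hk (Eventually.of_forall fun z => hC z.1 z.2)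
  calc ∫ x, (∫ y, k x y * f y ∂ν) * g x ∂μ = ∫ x, ∫ y, k x y * (g x * f y) ∂ν ∂μ := by
        refine integral_congr_ae (Eventually.of_forall fun x => ?_)
        simp only
        rw [← integral_mul_const]
        exact integral_congr_ae (Eventually.of_forall fun y => by simp only; ring)
    _ = ∫ y, ∫ x, k x y * (g x * f y) ∂μ ∂ν := integral_integral_swap h
    _ = ∫ y, f y * (∫ x, k x y * g x ∂μ) ∂ν := by
        refine integral_congr_ae (Eventually.of_forall fun y => ?_)
        simp only
        rw [← integral_const_mul]
        exact integral_congr_ae (Eventually.of_forall fun x => by simp only; ring)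

namespace PadicNonlocal

/-! ### Bruhat–Schwartz functions -/

section TestFunctions

variable {p : ℕ} [Fact p.Prime] {n : ℕ}

theorem IsTestFunction.exists_support {φ : Qpn p n → ℂ} (hφ : IsTestFunction φ) :
    ∃ l : ℤ, ∀ x, φ x ≠ 0 → ‖x‖ ≤ (p : ℝ) ^ l := by
  obtain ⟨R, hR⟩ := hφ.2.isBounded.exists_norm_le
  obtain ⟨l, hl⟩ := exists_zpow_ge p R
  exact ⟨l, fun x hx => (hR x (subset_tsupport _ hx)).trans hl⟩

theorem exists_zpow_lt (p : ℕ) [Fact p.Prime] {r : ℝ} (hr : 0 < r) : ∃ m : ℤ, (p : ℝ) ^ m < r := by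
  obtain ⟨k, hk⟩ := pow_unbounded_of_one_lt r⁻¹ (one_lt_prime_real p)
  refine ⟨-k, ?_⟩
  rw [zpow_neg, zpow_natCast]
  exact inv_lt_of_inv_lt₀ hr hk

/-- Local constancy is uniform because the support is compact: a Lebesgue number of the cover by
level sets gives the radius. If only `x + z` lies in the support, the argument is centred there
instead of at `x`. -/
theorem IsTestFunction.exists_period {φ : Qpn p n → ℂ} (hφ : IsTestFunction φ) :
    ∃ m : ℤ, ∀ x z, ‖z‖ ≤ (p : ℝ) ^ m → φ (x + z) = φ x := by
  obtain ⟨δ, hδ, h⟩ := lebesgue_number_lemma_of_metric (c := fun v : ℂ => φ ⁻¹' {v}) hφ.2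
    (fun v => hφ.1 _) (fun x _ => Set.mem_iUnion.2 ⟨φ x, rfl⟩)
  have key : ∀ x ∈ tsupport φ, ∀ y, dist y x < δ → φ y = φ x := by
    intro x hx y hy
    obtain ⟨v, hv⟩ := h x hx
    exact (hv hy).trans (hv (Metric.mem_ball_self hδ)).symm
  obtain ⟨m, hm⟩ := exists_zpow_lt p hδ
  refine ⟨m, fun x z hz => ?_⟩
  have hd : dist (x + z) x < δ := by
    rw [dist_eq_norm, add_sub_cancel_left]; exact hz.trans_lt hm
  by_cases hx : x ∈ tsupport φ
  · exact key x hx _ hd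
  by_cases hxz : x + z ∈ tsupport φ
  · exact (key _ hxz x (by rwa [dist_comm])).symm
  · rw [image_eq_zero_of_notMem_tsupport hx, image_eq_zero_of_notMem_tsupport hxz]

theorem isLocallyConstant_of_period {φ : Qpn p n → ℂ} {m : ℤ}
    (h : ∀ x z, ‖z‖ ≤ (p : ℝ) ^ m → φ (x + z) = φ x) : IsLocallyConstant φ := by
  have hpR := prime_pos_real p
  refine (IsLocallyConstant.iff_exists_open _).2 fun x =>
    ⟨Metric.ball x ((p : ℝ) ^ m), Metric.isOpen_ball, Metric.mem_ball_self (by positivity),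
      fun y hy => ?_⟩
  rw [Metric.mem_ball, dist_eq_norm] at hy
  rw [← h x (y - x) hy.le, add_sub_cancel]

theorem isTestFunction_of_period {φ : Qpn p n → ℂ} {l m : ℤ}
    (hl : ∀ x, φ x ≠ 0 → ‖x‖ ≤ (p : ℝ) ^ l)
    (hm : ∀ x z, ‖z‖ ≤ (p : ℝ) ^ m → φ (x + z) = φ x) : IsTestFunction φ := by
  refine ⟨isLocallyConstant_of_period hm,
    HasCompactSupport.intro (isCompact_closedBall 0 ((p : ℝ) ^ l)) fun x hx => ?_⟩
  by_contra h0
  exact hx (mem_closedBall_zero_iff.2 (hl x h0))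

theorem IsTestFunction.continuous {φ : Qpn p n → ℂ} (hφ : IsTestFunction φ) : Continuous φ :=
  hφ.1.continuous

theorem IsTestFunction.integrable {φ : Qpn p n → ℂ} (hφ : IsTestFunction φ) :
    Integrable φ (haar p n) :=
  hφ.continuous.integrable_of_hasCompactSupport hφ.2

theorem IsTestFunction.memLp {φ : Qpn p n → ℂ} (hφ : IsTestFunction φ) (q : ℝ≥0∞) :
    MemLp φ q (haar p n) :=
  hφ.continuous.memLp_of_hasCompactSupport hφ.2

theorem IsTestFunction.exists_norm_le {φ : Qpn p n → ℂ} (hφ : IsTestFunction φ) :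
    ∃ C, ∀ x, ‖φ x‖ ≤ C :=
  hφ.2.exists_bound_of_continuous hφ.continuous

theorem IsTestFunction.conj {φ : Qpn p n → ℂ} (hφ : IsTestFunction φ) :
    IsTestFunction fun x => starRingEnd ℂ (φ x) :=
  ⟨hφ.1.comp _, hφ.2.comp_left (map_zero _)⟩

theorem IsTestFunction.comp_neg {φ : Qpn p n → ℂ} (hφ : IsTestFunction φ) :
    IsTestFunction fun x => φ (-x) :=
  ⟨hφ.1.comp_continuous continuous_neg, hφ.2.comp_homeomorph (Homeomorph.neg _)⟩

theorem IsTestFunction.add {φ ψ : Qpn p n → ℂ} (hφ : IsTestFunction φ) (hψ : IsTestFunction ψ) :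
    IsTestFunction (φ + ψ) :=
  ⟨hφ.1.add hψ.1, hφ.2.add hψ.2⟩

theorem IsTestFunction.const_smul {φ : Qpn p n → ℂ} (hφ : IsTestFunction φ) (c : ℂ) :
    IsTestFunction (c • φ) :=
  ⟨hφ.1.comp (c • ·), hφ.2.smul_left (f := fun _ => c)⟩

theorem isTestFunction_zero : IsTestFunction (0 : Qpn p n → ℂ) :=
  ⟨IsLocallyConstant.const 0, HasCompactSupport.zero⟩

end TestFunctions

/-! ### Fourier inversion and Parseval on test functions -/

section Fourier

variable {p : ℕ} [Fact p.Prime] {n : ℕ}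

theorem continuous_Psi_neg_dot :
    Continuous fun z : Qpn p n × Qpn p n => Psi (-dot z.1 z.2) :=
  continuous_Psi.comp (by unfold dot; fun_prop)

theorem invFourierIntegral_eq (g : Qpn p n → ℂ) (x : Qpn p n) :
    invFourierIntegral g x = fourierIntegral g (-x) := by
  simp only [invFourierIntegral, fourierIntegral, neg_dot, neg_neg, dot_comm x]

theorem integrable_Psi_mul {g : Qpn p n → ℂ} (hg : Integrable g (haar p n)) (ξ : Qpn p n) :
    Integrable (fun x => Psi (dot ξ x) * g x) (haar p n) :=
  hg.bdd_mul (continuous_Psi_dot_left ξ).aestronglyMeasurable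
    (Eventually.of_forall fun _ => (norm_Psi _).le)

/-- Invariance of `φ` under a ball forces its transform to live on the dual ball: a shift by `z`
multiplies the integral by a character value different from `1`. -/
theorem fourierIntegral_eq_zero {φ : Qpn p n → ℂ} {m : ℤ}
    (hm : ∀ x z, ‖z‖ ≤ (p : ℝ) ^ m → φ (x + z) = φ x) {ξ : Qpn p n}
    (hξ : (p : ℝ) ^ (-m) < ‖ξ‖) : fourierIntegral φ ξ = 0 := by
  obtain ⟨z, hz, hne⟩ := exists_Psi_dot_ne_one (ξ := -ξ) (by rwa [norm_neg])
  have h2 : fourierIntegral φ ξ = Psi (dot (-ξ) z) * fourierIntegral φ ξ := by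
    conv_lhs => rw [fourierIntegral, ← integral_add_right_eq_self _ z]
    rw [fourierIntegral, ← integral_const_mul]
    refine integral_congr_ae (Eventually.of_forall fun x => ?_)
    simp only
    rw [hm x z hz, ← neg_dot, dot_add, Psi_add, neg_dot ξ x]
    ring
  have h3 : (1 - Psi (dot (-ξ) z)) * fourierIntegral φ ξ = 0 := by
    rw [sub_mul, one_mul, ← h2, sub_self]
  exact (mul_eq_zero.1 h3).resolve_left (sub_ne_zero.2 (Ne.symm hne))

theorem fourierIntegral_period {φ : Qpn p n → ℂ} {l : ℤ}
    (hl : ∀ x, φ x ≠ 0 → ‖x‖ ≤ (p : ℝ) ^ l) (ξ z : Qpn p n) (hz : ‖z‖ ≤ (p : ℝ) ^ (-l)) :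
    fourierIntegral φ (ξ + z) = fourierIntegral φ ξ := by
  refine integral_congr_ae (Eventually.of_forall fun x => ?_)
  simp only
  by_cases hx : φ x = 0
  · rw [hx, mul_zero, mul_zero]
  · rw [← neg_dot, neg_add, dot_comm, dot_add, Psi_add, dot_comm x (-z),
      Psi_dot_eq_one (by rwa [norm_neg]) (hl x hx), mul_one, dot_comm, neg_dot]

theorem IsTestFunction.fourierIntegral {φ : Qpn p n → ℂ} (hφ : IsTestFunction φ) :
    IsTestFunction (fourierIntegral φ) := by
  obtain ⟨l, hl⟩ := hφ.exists_support
  obtain ⟨m, hm⟩ := hφ.exists_period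
  refine isTestFunction_of_period (l := -m) (m := -l) (fun ξ hξ => ?_) (fourierIntegral_period hl)
  by_contra h
  exact hξ (fourierIntegral_eq_zero hm (not_le.1 h))

theorem IsTestFunction.invFourierIntegral {φ : Qpn p n → ℂ} (hφ : IsTestFunction φ) :
    IsTestFunction (invFourierIntegral φ) := by
  have : PadicNonlocal.invFourierIntegral φ = fun x => PadicNonlocal.fourierIntegral φ (-x) :=
    funext (invFourierIntegral_eq φ)
  rw [this]
  exact hφ.fourierIntegral.comp_neg

theorem integral_fourierIntegral_mul {f g : Qpn p n → ℂ} (hf : Integrable f (haar p n))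
    (hg : Integrable g (haar p n)) :
    ∫ ξ, fourierIntegral f ξ * g ξ ∂(haar p n) = ∫ x, f x * fourierIntegral g x ∂(haar p n) := by
  have h := integral_kernel_mul_comm (k := fun ξ x : Qpn p n => Psi (-dot ξ x)) (C := 1)
    (μ := haar p n) (ν := haar p n)
    continuous_Psi_neg_dot.aestronglyMeasurable (fun _ _ => (norm_Psi _).le) hf hg
  simpa only [fourierIntegral, dot_comm] using h

theorem integral_invFourierIntegral_mul {f g : Qpn p n → ℂ} (hf : Integrable f (haar p n))
    (hg : Integrable g (haar p n)) :
    ∫ ξ, invFourierIntegral f ξ * g ξ ∂(haar p n) =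
      ∫ x, f x * invFourierIntegral g x ∂(haar p n) := by
  have h := integral_kernel_mul_comm (k := fun ξ x : Qpn p n => Psi (dot ξ x)) (C := 1)
    (μ := haar p n) (ν := haar p n)
    continuous_Psi_dot.aestronglyMeasurable (fun _ _ => (norm_Psi _).le) hf hg
  simpa only [invFourierIntegral, dot_comm] using h

/-- The transform is supported in the ball `B`, so Fubini applies on the finite measure space `B`.
The inner character integral is `vol B` times the indicator of the dual ball around `x`, on which
`φ` is constant, and the two volumes multiply to `1`. -/
theorem invFourierIntegral_fourierIntegral {φ : Qpn p n → ℂ} (hφ : IsTestFunction φ)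
    (x : Qpn p n) : invFourierIntegral (fourierIntegral φ) x = φ x := by
  obtain ⟨m, hm⟩ := hφ.exists_period
  set B := Metric.closedBall (0 : Qpn p n) ((p : ℝ) ^ (-m)) with hB
  have hBm : MeasurableSet B := Metric.isClosed_closedBall.measurableSet
  have : IsFiniteMeasure ((haar p n).restrict B) := ⟨by
    rw [Measure.restrict_apply_univ]; exact measure_closedBall_lt_top⟩
  have h1 : invFourierIntegral (fourierIntegral φ) x =
      ∫ ξ in B, fourierIntegral φ ξ * Psi (dot x ξ) ∂(haar p n) := by
    rw [setIntegral_eq_integral_of_forall_compl_eq_zero]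
    · simp only [invFourierIntegral, mul_comm, dot_comm x]
    · intro ξ hξ
      rw [fourierIntegral_eq_zero hm (not_le.1 (mt mem_closedBall_zero_iff.2 hξ)), zero_mul]
  have h2 := integral_kernel_mul_comm (k := fun ξ t : Qpn p n => Psi (-dot ξ t)) (C := 1)
    (μ := (haar p n).restrict B) (ν := haar p n) (g := fun ξ => Psi (dot x ξ))
    continuous_Psi_neg_dot.aestronglyMeasurable (fun _ _ => (norm_Psi _).le) hφ.integrable
    ((continuous_Psi_dot_left x).continuousOn.integrableOn_compact (isCompact_closedBall _ _))
  have h3 : ∀ t, ∫ ξ in B, Psi (-dot ξ t) * Psi (dot x ξ) ∂(haar p n) =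
      (Metric.closedBall x ((p : ℝ) ^ m)).indicator (fun _ => (ballVol p n (-m) : ℂ)) t := by
    intro t
    have h := setIntegral_closedBall_Psi (x - t) (-m)
    have h' : ∀ ξ, Psi (-dot ξ t) * Psi (dot x ξ) = Psi (dot (x - t) ξ) := fun ξ => by
      rw [← Psi_add, dot_comm (x - t), dot_sub, dot_comm x]
      congr 1
      ring
    simp only [h', hB, h, neg_neg]
    by_cases ht : ‖x - t‖ ≤ (p : ℝ) ^ m
    · rw [if_pos ht, Set.indicator_of_mem]
      rwa [Metric.mem_closedBall', dist_eq_norm]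
    · rw [if_neg ht, Set.indicator_of_notMem]
      rwa [Metric.mem_closedBall', dist_eq_norm]
  rw [h1]
  simp only [fourierIntegral]
  rw [h2]
  simp only [h3]
  have h4 : ∀ t, φ t * (Metric.closedBall x ((p : ℝ) ^ m)).indicator
        (fun _ => (ballVol p n (-m) : ℂ)) t =
      (Metric.closedBall x ((p : ℝ) ^ m)).indicator
        (fun _ => φ x * (ballVol p n (-m) : ℂ)) t := by
    intro t
    by_cases ht : t ∈ Metric.closedBall x ((p : ℝ) ^ m)
    · rw [Set.indicator_of_mem ht, Set.indicator_of_mem ht, ← hm x (t - x), add_sub_cancel]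
      rwa [← dist_eq_norm]
    · rw [Set.indicator_of_notMem ht, Set.indicator_of_notMem ht, mul_zero]
  simp only [h4]
  rw [integral_indicator Metric.isClosed_closedBall.measurableSet, setIntegral_const,
    haar_real_closedBall, Complex.real_smul, mul_left_comm, ← Complex.ofReal_mul,
    ballVol_mul_ballVol_neg, Complex.ofReal_one, mul_one]

theorem fourierIntegral_invFourierIntegral {φ : Qpn p n → ℂ} (hφ : IsTestFunction φ)
    (x : Qpn p n) : fourierIntegral (invFourierIntegral φ) x = φ x := by
  rw [← invFourierIntegral_fourierIntegral hφ x, fourierIntegral, PadicNonlocal.invFourierIntegral,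
    ← integral_neg_eq_self]
  refine integral_congr_ae (Eventually.of_forall fun ξ => ?_)
  simp only [invFourierIntegral_eq, neg_dot, neg_neg, dot_comm x]

theorem conj_fourierIntegral (φ : Qpn p n → ℂ) (ξ : Qpn p n) :
    starRingEnd ℂ (fourierIntegral φ ξ) =
      invFourierIntegral (fun x => starRingEnd ℂ (φ x)) ξ := by
  rw [fourierIntegral, invFourierIntegral, ← integral_conj]
  refine integral_congr_ae (Eventually.of_forall fun x => ?_)
  simp only [map_mul, Psi_neg, RingHomCompTriple.comp_apply, RingHom.id_apply, dot_comm ξ]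

/-- The multiplication formula moves one transform onto the other factor, where it cancels the
inverse transform produced by conjugation. -/
theorem integral_fourierIntegral_mul_conj {φ ψ : Qpn p n → ℂ} (hφ : IsTestFunction φ)
    (hψ : IsTestFunction ψ) :
    ∫ ξ, fourierIntegral φ ξ * starRingEnd ℂ (fourierIntegral ψ ξ) ∂(haar p n) =
      ∫ x, φ x * starRingEnd ℂ (ψ x) ∂(haar p n) := by
  simp only [conj_fourierIntegral]
  rw [integral_fourierIntegral_mul hφ.integrable hψ.conj.invFourierIntegral.integrable]
  simp only [fourierIntegral_invFourierIntegral hψ.conj]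

end Fourier


/-! ### The operator on test functions -/

section NonlocalOp

variable {p : ℕ} [Fact p.Prime] {n : ℕ} {w : Qpn p n → ℝ}

theorem sub_eq_zero_of_period {φ : Qpn p n → ℂ} {m : ℤ}
    (hm : ∀ x z, ‖z‖ ≤ (p : ℝ) ^ m → φ (x + z) = φ x) (x y : Qpn p n)
    (hy : ‖y‖ ≤ (p : ℝ) ^ m) : φ (x - y) - φ x = 0 := by
  rw [sub_eq_add_neg x y, hm x (-y) (by rwa [norm_neg]), sub_self]

theorem integrable_nonlocalOp_integrand (hw : IsAdmissible w) {φ : Qpn p n → ℂ}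
    (hφ : IsTestFunction φ) (x : Qpn p n) :
    Integrable (fun y => (φ (x - y) - φ x) / (w y : ℂ)) (haar p n) := by
  obtain ⟨m, hm⟩ := hφ.exists_period
  obtain ⟨C, hC⟩ := hφ.exists_norm_le
  simp only [div_eq_mul_cutoffInv (w := w) (sub_eq_zero_of_period hm x)]
  have hcont : Continuous fun y => φ (x - y) - φ x :=
    (hφ.continuous.comp (continuous_const.sub continuous_id)).sub continuous_const
  exact integrable_mul_cutoffInv hw m (C := C + C) hcont.aestronglyMeasurable
    fun y => (norm_sub_le _ _).trans (add_le_add (hC _) (hC _))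

theorem nonlocalOp_eq {φ : Qpn p n → ℂ} {m : ℤ} (κ : ℝ)
    (hm : ∀ x z, ‖z‖ ≤ (p : ℝ) ^ m → φ (x + z) = φ x) (x : Qpn p n) :
    nonlocalOp κ w φ x =
      κ * ∫ y, (φ (x - y) - φ x) * (cutoffInv w m y : ℂ) ∂(haar p n) := by
  simp only [nonlocalOp, div_eq_mul_cutoffInv (w := w) (sub_eq_zero_of_period hm x)]

theorem exists_norm_nonlocalOp_le (hw : IsAdmissible w) (κ : ℝ) {φ : Qpn p n → ℂ}
    (hφ : IsTestFunction φ) : ∃ C, ∀ x, ‖nonlocalOp κ w φ x‖ ≤ C := by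
  obtain ⟨m, hm⟩ := hφ.exists_period
  obtain ⟨C, hC⟩ := hφ.exists_norm_le
  refine ⟨‖(κ : ℂ)‖ * ((C + C) * ∫ y, cutoffInv w m y ∂(haar p n)), fun x => ?_⟩
  rw [nonlocalOp_eq κ hm, norm_mul]
  gcongr
  exact norm_integral_mul_cutoffInv_le hw m
    fun y => (norm_sub_le _ _).trans (add_le_add (hC _) (hC _))

/-- Translation invariance: the image inherits the periods of `φ`, hence is even locally constant.
-/
theorem continuous_nonlocalOp (κ : ℝ) {φ : Qpn p n → ℂ} (hφ : IsTestFunction φ) :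
    Continuous (nonlocalOp κ w φ) := by
  obtain ⟨m, hm⟩ := hφ.exists_period
  refine (isLocallyConstant_of_period (m := m) fun x z hz => ?_).continuous
  simp only [nonlocalOp, hm x z hz, add_sub_right_comm x z, hm _ z hz]

/-- After the cutoff, the operator is convolution with an integrable kernel minus a multiple of `φ`.
-/
theorem integrable_nonlocalOp (hw : IsAdmissible w) (κ : ℝ) {φ : Qpn p n → ℂ}
    (hφ : IsTestFunction φ) : Integrable (nonlocalOp κ w φ) (haar p n) := by
  obtain ⟨m, hm⟩ := hφ.exists_period
  rw [show nonlocalOp κ w φ = fun x => _ from funext (nonlocalOp_eq κ hm)]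
  have h1 : Integrable (fun z : Qpn p n × Qpn p n => φ (z.1 - z.2) * (cutoffInv w m z.2 : ℂ))
      ((haar p n).prod (haar p n)) := by
    have := (integrable_cutoffInv_ofReal hw m).convolution_integrand (ContinuousLinearMap.mul ℂ ℂ)
      hφ.integrable
    refine this.congr (Eventually.of_forall fun z => ?_)
    simp [mul_comm]
  have h2 := hφ.integrable.mul_prod (integrable_cutoffInv_ofReal hw m)
  refine Integrable.const_mul ?_ _
  refine ((h1.sub h2).congr (Eventually.of_forall fun z => ?_)).integral_prod_left
    (f := fun z : Qpn p n × Qpn p n => (φ (z.1 - z.2) - φ z.1) * (cutoffInv w m z.2 : ℂ))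
  simp [sub_mul]

/-- Although `A_w` may be unbounded, it is bounded on the ball that contains the support of the
transform. -/
theorem exists_norm_symbolA_mul_fourierIntegral_le (hw : IsAdmissible w) {φ : Qpn p n → ℂ}
    (hφ : IsTestFunction φ) :
    ∃ C, ∀ ξ, ‖symbolA w ξ * fourierIntegral φ ξ‖ ≤ C * ‖fourierIntegral φ ξ‖ := by
  obtain ⟨m, hm⟩ := hφ.exists_period
  refine ⟨2 * ∫ y, cutoffInv w m y ∂(haar p n), fun ξ => ?_⟩
  rw [norm_mul]
  rcases le_or_gt ‖ξ‖ ((p : ℝ) ^ (-m)) with h | h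
  · gcongr
    exact norm_symbolA_le hw h
  · simp [fourierIntegral_eq_zero hm h]

theorem memLp_symbolA_mul_fourierIntegral (hw : IsAdmissible w) {φ : Qpn p n → ℂ}
    (hφ : IsTestFunction φ) (q : ℝ≥0∞) :
    MemLp (fun ξ => symbolA w ξ * fourierIntegral φ ξ) q (haar p n) := by
  obtain ⟨C, hC⟩ := exists_norm_symbolA_mul_fourierIntegral_le hw hφ
  exact (hφ.fourierIntegral.memLp q).of_le_mul
    ((stronglyMeasurable_symbolA hw).aestronglyMeasurable.mul
      hφ.fourierIntegral.continuous.aestronglyMeasurable) (Eventually.of_forall hC)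

theorem integrable_symbolA_mul_fourierIntegral (hw : IsAdmissible w) {φ : Qpn p n → ℂ}
    (hφ : IsTestFunction φ) :
    Integrable (fun ξ => symbolA w ξ * fourierIntegral φ ξ) (haar p n) :=
  memLp_one_iff_integrable.1 (memLp_symbolA_mul_fourierIntegral hw hφ 1)

/-- On the support of the transform one cutoff radius serves all `ξ`, so the `ξ` and `y` integrals
may be exchanged; by inversion the `ξ` integral is `φ x - φ (x - y)`. -/
theorem nonlocalOp_eq_invFourierIntegral (hw : IsAdmissible w) (κ : ℝ) {φ : Qpn p n → ℂ}
    (hφ : IsTestFunction φ) (x : Qpn p n) :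
    nonlocalOp κ w φ x =
      -(κ : ℂ) * invFourierIntegral (fun ξ => symbolA w ξ * fourierIntegral φ ξ) x := by
  obtain ⟨m, hm⟩ := hφ.exists_period
  have h1 : invFourierIntegral (fun ξ => symbolA w ξ * fourierIntegral φ ξ) x =
      ∫ ξ, (∫ y, (1 - Psi (-dot y ξ)) * (cutoffInv w m y : ℂ) ∂(haar p n)) *
        (Psi (dot ξ x) * fourierIntegral φ ξ) ∂(haar p n) := by
    rw [invFourierIntegral]
    refine integral_congr_ae (Eventually.of_forall fun ξ => ?_)
    simp only
    rcases le_or_gt ‖ξ‖ ((p : ℝ) ^ (-m)) with h | h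
    · rw [symbolA_eq_integral_cutoffInv h]
      ring
    · rw [fourierIntegral_eq_zero hm h]
      simp
  have hk : Continuous fun z : Qpn p n × Qpn p n => 1 - Psi (-dot z.2 z.1) :=
    continuous_const.sub (continuous_Psi.comp (by unfold dot; fun_prop))
  have h2 : ∀ x' : Qpn p n, Integrable (fun ξ => Psi (dot ξ x') * fourierIntegral φ ξ)
      (haar p n) := fun x' => by
    simpa only [dot_comm x'] using integrable_Psi_mul hφ.fourierIntegral.integrable x'
  have h3 : ∀ y, ∫ ξ, (1 - Psi (-dot y ξ)) * (Psi (dot ξ x) * fourierIntegral φ ξ) ∂(haar p n) =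
      φ x - φ (x - y) := by
    intro y
    have h4 : ∀ ξ, (1 - Psi (-dot y ξ)) * (Psi (dot ξ x) * fourierIntegral φ ξ) =
        Psi (dot ξ x) * fourierIntegral φ ξ - Psi (dot ξ (x - y)) * fourierIntegral φ ξ := by
      intro ξ
      rw [dot_sub, sub_eq_add_neg (dot ξ x), Psi_add, dot_comm y]
      ring
    simp only [h4]
    rw [integral_sub (h2 x) (h2 (x - y))]
    exact congrArg₂ (· - ·) (invFourierIntegral_fourierIntegral hφ x)
      (invFourierIntegral_fourierIntegral hφ (x - y))
  rw [h1, integral_kernel_mul_comm (k := fun ξ y => 1 - Psi (-dot y ξ)) (C := 2)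
    hk.aestronglyMeasurable (fun _ _ => norm_one_sub_Psi_le _)
    (integrable_cutoffInv_ofReal hw m) (h2 x), nonlocalOp_eq κ hm, neg_mul, ← mul_neg,
    ← integral_neg]
  congr 1
  refine integral_congr_ae (Eventually.of_forall fun y => ?_)
  simp only [h3]
  ring

theorem isFourierL2_nonlocalOp (hw : IsAdmissible w) (κ : ℝ) {φ : Qpn p n → ℂ}
    (hφ : IsTestFunction φ) :
    IsFourierL2 (nonlocalOp κ w φ)
      fun ξ => -(κ : ℂ) * (symbolA w ξ * fourierIntegral φ ξ) := by
  obtain ⟨C, hC⟩ := exists_norm_nonlocalOp_le hw κ hφ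
  refine ⟨(integrable_nonlocalOp hw κ hφ).memLp_of_norm_le hC one_le_two,
    (memLp_symbolA_mul_fourierIntegral hw hφ 2).const_mul _, fun ψ hψ => ?_⟩
  simp only [nonlocalOp_eq_invFourierIntegral hw κ hφ, mul_assoc, integral_const_mul]
  congr 1
  have h := integral_invFourierIntegral_mul (integrable_symbolA_mul_fourierIntegral hw hφ)
    hψ.fourierIntegral.integrable
  simp only [invFourierIntegral_fourierIntegral hψ, mul_assoc] at h
  exact h.symm

end NonlocalOp


/-! ### Density of test functions in `L²` -/

section Density

variable {p : ℕ} [Fact p.Prime] {n : ℕ}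

/-- A function that is uniformly close on cosets of a ball is close to a function that is constant
on these cosets. -/
theorem exists_periodic_approx (g : Qpn p n → ℂ) (m : ℤ) {c : ℝ}
    (hg : ∀ x y, ‖x - y‖ ≤ (p : ℝ) ^ m → dist (g x) (g y) ≤ c) :
    ∃ φ : Qpn p n → ℂ, (∀ x z, ‖z‖ ≤ (p : ℝ) ^ m → φ (x + z) = φ x) ∧
      (∀ x, dist (g x) (φ x) ≤ c) ∧ ∀ x, φ x ≠ 0 → ∃ y, ‖x - y‖ ≤ (p : ℝ) ^ m ∧ g y ≠ 0 := by
  have hpR := prime_pos_real p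
  let s : Setoid (Qpn p n) :=
    { r := fun x y => ‖x - y‖ ≤ (p : ℝ) ^ m
      iseqv := ⟨fun x => by rw [sub_self, norm_zero]; positivity,
        fun {x y} h => by rwa [norm_sub_rev],
        fun {x y z} h h' => by
          rw [← sub_add_sub_cancel x y z]
          exact (IsUltrametricDist.norm_add_le_max _ _).trans (max_le h h')⟩ }
  have hout : ∀ x : Qpn p n, ‖x - (Quotient.mk s x).out‖ ≤ (p : ℝ) ^ m := fun x =>
    s.symm (Quotient.exact (Quotient.out_eq (Quotient.mk s x)))
  -- On each coset the approximant takes the value of `g` at a chosen representative.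
  refine ⟨fun x => g (Quotient.mk s x).out, fun x z hz => ?_, fun x => hg _ _ (hout x),
    fun x hx => ⟨_, hout x, hx⟩⟩
  have : Quotient.mk s (x + z) = Quotient.mk s x :=
    Quotient.sound (show ‖x + z - x‖ ≤ (p : ℝ) ^ m by rwa [add_sub_cancel_left])
  simp only [this]

theorem exists_testFunction_eLpNorm_sub_le {f : Qpn p n → ℂ} (hf : MemLp f 2 (haar p n))
    {ε : ℝ≥0∞} (hε : ε ≠ 0) :
    ∃ φ : Qpn p n → ℂ, IsTestFunction φ ∧ eLpNorm (f - φ) 2 (haar p n) ≤ ε := by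
  have hp1 := one_lt_prime_real p
  have hε2 : ε / 2 ≠ 0 := (ENNReal.half_pos hε).ne'
  obtain ⟨g, hgs, hfg, hgc, hgm⟩ :=
    hf.exists_hasCompactSupport_eLpNorm_sub_le ENNReal.ofNat_ne_top hε2
  obtain ⟨R, hR⟩ := hgs.isBounded.exists_norm_le
  obtain ⟨l, hl⟩ := exists_zpow_ge p R
  set B := Metric.closedBall (0 : Qpn p n) ((p : ℝ) ^ l) with hB
  have hBm : MeasurableSet B := Metric.isClosed_closedBall.measurableSet
  have hBfin : haar p n B ^ (1 / (2 : ℝ≥0∞).toReal) ≠ ∞ :=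
    ENNReal.rpow_ne_top_of_nonneg (by positivity) measure_closedBall_lt_top.ne
  -- A uniform error `c` on `B` costs `c * vol(B) ^ (1/2)` in `L²`; `c` is chosen to keep this below
  -- `ε / 2`.
  obtain ⟨c, hc, hcε⟩ := ENNReal.exists_nnreal_pos_mul_lt hBfin hε2
  obtain ⟨δ, hδ, hgδ⟩ := Metric.uniformContinuous_iff.1
    (hgs.uniformContinuous_of_continuous hgc) c hc
  obtain ⟨m', hm'⟩ := exists_zpow_lt p hδ
  -- Having `m ≤ l` ensures that rounding on cosets does not enlarge the support beyond `B`.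
  set m := min m' l
  have hmδ : (p : ℝ) ^ m < δ := (zpow_le_zpow_right₀ hp1.le (min_le_left _ _)).trans_lt hm'
  have hml : (p : ℝ) ^ m ≤ (p : ℝ) ^ l := zpow_le_zpow_right₀ hp1.le (min_le_right _ _)
  have hgB : ∀ x, g x ≠ 0 → ‖x‖ ≤ (p : ℝ) ^ l := fun x hx => (hR x (subset_tsupport _ hx)).trans hl
  obtain ⟨φ, hφm, hφg, hφs⟩ := exists_periodic_approx g m (c := c) fun x y hxy =>
    (hgδ (by rw [dist_eq_norm]; exact hxy.trans_lt hmδ)).le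
  have hφB : ∀ x, φ x ≠ 0 → ‖x‖ ≤ (p : ℝ) ^ l := by
    intro x hx
    obtain ⟨y, hxy, hy⟩ := hφs x hx
    rw [← sub_add_cancel x y]
    exact (IsUltrametricDist.norm_add_le_max _ _).trans (max_le (hxy.trans hml) (hgB y hy))
  have hφ := isTestFunction_of_period hφB hφm
  refine ⟨φ, hφ, ?_⟩
  have h2 : eLpNorm (g - φ) 2 (haar p n) ≤ ε / 2 := by
    refine (eLpNorm_sub_le_of_dist_bdd (haar p n) ENNReal.ofNat_ne_top hBm c.2 hφg
      (fun x hx => mem_closedBall_zero_iff.2 (hgB x hx))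
      (fun x hx => mem_closedBall_zero_iff.2 (hφB x hx))).trans ?_
    simpa using hcε.le
  calc eLpNorm (f - φ) 2 (haar p n) = eLpNorm ((f - g) + (g - φ)) 2 (haar p n) := by
        rw [sub_add_sub_cancel]
    _ ≤ eLpNorm (f - g) 2 (haar p n) + eLpNorm (g - φ) 2 (haar p n) :=
        eLpNorm_add_le (hf.1.sub hgm.1) (hgm.1.sub (hφ.memLp 2).1) one_le_two
    _ ≤ ε := (add_le_add hfg h2).trans (ENNReal.add_halves ε).le

end Density

/-! ### The unitary Fourier transform on `L²` -/

section Plancherel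

variable (p : ℕ) [Fact p.Prime] (n : ℕ)

/-- The space of Bruhat–Schwartz functions. -/
def testFunctions : Submodule ℂ (Qpn p n → ℂ) where
  carrier := {φ | IsTestFunction φ}
  add_mem' := fun h h' => h.add h'
  zero_mem' := isTestFunction_zero
  smul_mem' := fun c _ h => h.const_smul c

/-- The Fourier transform on Bruhat–Schwartz functions. -/
def testFourier : testFunctions p n ≃ₗ[ℂ] testFunctions p n where
  toFun φ := ⟨fourierIntegral φ, IsTestFunction.fourierIntegral φ.2⟩
  invFun φ := ⟨invFourierIntegral φ, IsTestFunction.invFourierIntegral φ.2⟩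
  map_add' φ ψ := by
    refine Subtype.ext (funext fun ξ => ?_)
    have hi : ∀ χ : testFunctions p n,
        Integrable (fun x => Psi (-dot ξ x) * (χ : Qpn p n → ℂ) x) (haar p n) := fun χ => by
      simpa only [neg_dot] using integrable_Psi_mul (IsTestFunction.integrable χ.2) (-ξ)
    refine Eq.trans ?_ (integral_add (hi φ) (hi ψ))
    exact integral_congr_ae (Eventually.of_forall fun x => mul_add _ _ _)
  map_smul' c φ := by
    refine Subtype.ext (funext fun ξ => ?_)
    simp [fourierIntegral, mul_left_comm _ c, integral_const_mul]
  left_inv φ := Subtype.ext (funext (invFourierIntegral_fourierIntegral φ.2))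
  right_inv φ := Subtype.ext (funext (fourierIntegral_invFourierIntegral φ.2))

/-- The inclusion of the Bruhat–Schwartz functions into `L²`. -/
def testToL2 : testFunctions p n →ₗ[ℂ] L2 p n where
  toFun φ := (IsTestFunction.memLp φ.2 2).toLp
  map_add' φ ψ := MemLp.toLp_add (IsTestFunction.memLp φ.2 2) (IsTestFunction.memLp ψ.2 2)
  map_smul' c φ := MemLp.toLp_const_smul c (IsTestFunction.memLp φ.2 2)

variable {p n}

theorem coeFn_testToL2 (φ : testFunctions p n) : testToL2 p n φ =ᵐ[haar p n] φ :=
  MemLp.coeFn_toLp (IsTestFunction.memLp φ.2 2)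

theorem denseRange_testToL2 : DenseRange (testToL2 p n) := by
  intro f
  refine EMetric.mem_closure_iff.2 fun ε hε => ?_
  obtain ⟨φ, hφ, h⟩ := exists_testFunction_eLpNorm_sub_le (Lp.memLp f)
    (ENNReal.half_pos hε.ne').ne'
  rcases eq_or_ne ε ∞ with rfl | hε'
  · exact ⟨0, ⟨0, map_zero _⟩, edist_lt_top _ _⟩
  refine ⟨_, ⟨⟨φ, hφ⟩, rfl⟩, ?_⟩
  rw [Lp.edist_def]
  refine lt_of_le_of_lt ?_ (ENNReal.half_lt_self hε.ne' hε')
  refine (eLpNorm_congr_ae ?_).trans_le h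
  exact (ae_eq_refl _).sub (coeFn_testToL2 ⟨φ, hφ⟩)

/-- Turns the bilinear distributional pairing into an inner product, making it continuous in `f` and
accessible to density arguments. -/
theorem inner_testToL2_conj {φ : Qpn p n → ℂ} (hφ : IsTestFunction φ) (f : L2 p n) :
    inner ℂ (testToL2 p n ⟨_, hφ.conj⟩) f = ∫ x, f x * φ x ∂(haar p n) := by
  rw [L2.inner_def]
  refine integral_congr_ae ?_
  filter_upwards [coeFn_testToL2 (⟨_, hφ.conj⟩ : testFunctions p n)] with x hx
  rw [hx]
  simp [RCLike.inner_apply]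

theorem norm_testToL2_testFourier (φ : testFunctions p n) :
    ‖testToL2 p n (testFourier p n φ)‖ = ‖testToL2 p n φ‖ := by
  have key : ∀ ψ : testFunctions p n, inner ℂ (testToL2 p n ψ) (testToL2 p n ψ) =
      ∫ x, (ψ : Qpn p n → ℂ) x * starRingEnd ℂ ((ψ : Qpn p n → ℂ) x) ∂(haar p n) := by
    intro ψ
    rw [L2.inner_def]
    refine integral_congr_ae ?_
    filter_upwards [coeFn_testToL2 ψ] with x hx
    rw [hx, RCLike.inner_apply]
  have h : inner ℂ (testToL2 p n (testFourier p n φ)) (testToL2 p n (testFourier p n φ)) =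
      inner ℂ (testToL2 p n φ) (testToL2 p n φ) := by
    rw [key, key]
    exact integral_fourierIntegral_mul_conj φ.2 φ.2
  rw [inner_self_eq_norm_sq_to_K, inner_self_eq_norm_sq_to_K] at h
  exact (sq_eq_sq₀ (norm_nonneg _) (norm_nonneg _)).1 (by exact_mod_cast h)

variable (p n) in
/-- The Fourier transform on `L²`. -/
def fourierL2 : L2 p n ≃ₗᵢ[ℂ] L2 p n :=
  (testFourier p n).extendOfIsometry (testToL2 p n) (testToL2 p n) denseRange_testToL2
    denseRange_testToL2 norm_testToL2_testFourier

theorem fourierL2_testToL2 (φ : testFunctions p n) :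
    fourierL2 p n (testToL2 p n φ) = testToL2 p n (testFourier p n φ) :=
  LinearEquiv.extendOfIsometry_eq _ _ _ _ _ _ _

theorem integral_fourierL2_mul (f : L2 p n) {φ : Qpn p n → ℂ} (hφ : IsTestFunction φ) :
    ∫ ξ, fourierL2 p n f ξ * φ ξ ∂(haar p n) =
      ∫ x, f x * fourierIntegral φ x ∂(haar p n) := by
  rw [← inner_testToL2_conj hφ, ← inner_testToL2_conj hφ.fourierIntegral]
  refine denseRange_testToL2.induction_on (p := fun f : L2 p n =>
    inner ℂ (testToL2 p n ⟨_, hφ.conj⟩) (fourierL2 p n f) =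
      inner ℂ (testToL2 p n ⟨_, hφ.fourierIntegral.conj⟩) f) f
    (isClosed_eq (by fun_prop) (by fun_prop)) fun ψ => ?_
  rw [inner_testToL2_conj hφ, inner_testToL2_conj hφ.fourierIntegral, fourierL2_testToL2]
  have h := integral_fourierIntegral_mul (IsTestFunction.integrable ψ.2) hφ.integrable
  refine (integral_congr_ae ?_).trans (h.trans (integral_congr_ae ?_))
  · filter_upwards [coeFn_testToL2 (testFourier p n ψ)] with x hx
    rw [hx]; rfl
  · filter_upwards [coeFn_testToL2 ψ] with x hx
    rw [hx]

theorem isFourierL2_fourierL2 (f : L2 p n) : IsFourierL2 f (fourierL2 p n f) :=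
  ⟨Lp.memLp f, Lp.memLp _, fun _ hφ => integral_fourierL2_mul f hφ⟩

theorem IsFourierL2.congr {f f' g g' : Qpn p n → ℂ} (h : IsFourierL2 f g)
    (hf : f =ᵐ[haar p n] f') (hg : g =ᵐ[haar p n] g') : IsFourierL2 f' g' := by
  refine ⟨h.1.ae_eq hf, h.2.1.ae_eq hg, fun φ hφ => ?_⟩
  exact (integral_congr_ae (hg.symm.mul (ae_eq_refl φ))).trans
    ((h.2.2 φ hφ).trans (integral_congr_ae (hf.mul (ae_eq_refl _))))

/-- Test functions are dense, so pairings against them determine an `L²` function; the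
distributional transform therefore has no other candidate. -/
theorem isFourierL2_iff {f : L2 p n} {g : Qpn p n → ℂ} :
    IsFourierL2 f g ↔ g =ᵐ[haar p n] fourierL2 p n f := by
  refine ⟨fun h => ?_, fun h => (isFourierL2_fourierL2 f).congr (ae_eq_refl _) h.symm⟩
  have h0 : h.2.1.toLp = fourierL2 p n f := by
    refine denseRange_testToL2.eq_of_inner_right ℂ fun ψ => ?_
    have hψ : IsTestFunction fun x => starRingEnd ℂ ((ψ : Qpn p n → ℂ) x) :=
      IsTestFunction.conj ψ.2
    have hψψ : ψ = ⟨_, hψ.conj⟩ := Subtype.ext (funext fun x => by simp)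
    rw [hψψ, inner_testToL2_conj hψ, inner_testToL2_conj hψ, integral_fourierL2_mul f hψ,
      ← h.2.2 _ hψ]
    exact integral_congr_ae ((MemLp.coeFn_toLp h.2.1).mul (ae_eq_refl _))
  exact (MemLp.coeFn_toLp h.2.1).symm.trans (by rw [h0])

end Plancherel
end PadicNonlocal
end

noncomputable section

/-! ### Multiplication operators in a spectral representation -/

namespace MeasureTheory

variable {α : Type*} [MeasurableSpace α] {μ : Measure α}

/-- Dominated convergence in `L²`, along the natural numbers. -/
theorem Lp.tendsto_two_of_dominated {F : ℕ → Lp ℂ 2 μ} {f : Lp ℂ 2 μ} {c : α → ℝ}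
    (hc : MemLp c 2 μ) (hb : ∀ᶠ i in atTop, ∀ᵐ x ∂μ, ‖F i x - f x‖ ≤ c x)
    (h : ∀ᵐ x ∂μ, Tendsto (fun i => F i x) atTop (𝓝 (f x))) : Tendsto F atTop (𝓝 f) := by
  rw [Lp.tendsto_Lp_iff_tendsto_eLpNorm']
  have hpow : ∀ g : α → ℂ, eLpNorm g 2 μ = (∫⁻ x, ‖g x‖ₑ ^ (2 : ℝ) ∂μ) ^ (1 / 2 : ℝ) := fun g => by
    rw [eLpNorm_eq_lintegral_rpow_enorm_toReal two_ne_zero ENNReal.ofNat_ne_top]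
    simp
  simp only [hpow]
  have hfin : ∫⁻ x, ‖c x‖ₑ ^ (2 : ℝ) ∂μ ≠ ∞ := by
    have := lintegral_rpow_enorm_lt_top_of_eLpNorm_lt_top two_ne_zero ENNReal.ofNat_ne_top hc.2
    simpa using this.ne
  have key : Tendsto (fun i => ∫⁻ x, ‖(⇑(F i) - ⇑f) x‖ₑ ^ (2 : ℝ) ∂μ) atTop
      (𝓝 (∫⁻ _, 0 ∂μ)) := by
    refine tendsto_lintegral_filter_of_dominated_convergence (fun x => ‖c x‖ₑ ^ (2 : ℝ))
      (Eventually.of_forall fun i => ?_) ?_ hfin ?_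
    · exact (((Lp.stronglyMeasurable (F i)).sub (Lp.stronglyMeasurable f)).enorm).pow_const _
    · filter_upwards [hb] with i hi
      filter_upwards [hi] with x hx
      refine ENNReal.rpow_le_rpow ?_ zero_le_two
      rw [Pi.sub_apply, enorm_le_iff_norm_le]
      exact hx.trans (le_abs_self _)
    · filter_upwards [h] with x hx
      have h1 : Tendsto (fun i => ‖F i x - f x‖ₑ ^ (2 : ℝ)) atTop (𝓝 (‖f x - f x‖ₑ ^ (2 : ℝ))) :=
        ((ENNReal.continuous_rpow_const.comp continuous_enorm).tendsto _).comp
          (hx.sub tendsto_const_nhds)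
      simpa using h1
  rw [lintegral_zero] at key
  have := (ENNReal.continuous_rpow_const (y := (1 / 2 : ℝ))).tendsto 0 |>.comp key
  simpa [Function.comp_def] using this

end MeasureTheory

namespace SpectralMultiplier

variable {α : Type*} [MeasurableSpace α] {μ : Measure α}
  {H : Type*} [NormedAddCommGroup H] [InnerProductSpace ℂ H]
  (U : H ≃ₗᵢ[ℂ] Lp ℂ 2 μ)

/-- `g` is obtained from `f` by multiplication with `b` in the spectral representation `U`. -/
def MulRel (b : α → ℂ) (f g : H) : Prop := U g =ᵐ[μ] fun x => b x * U f x

variable {U}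

namespace MulRel

variable {b c : α → ℂ} {f g h : H}

theorem unique (hg : MulRel U b f g) (hh : MulRel U b f h) : g = h :=
  U.injective (Lp.ext (EventuallyEq.trans hg hh.symm))

theorem memLp (hg : MulRel U b f g) : MemLp (fun x => b x * U f x) 2 μ :=
  (Lp.memLp (U g)).ae_eq hg

theorem congr (hg : MulRel U b f g) (hbc : ∀ x, b x = c x) : MulRel U c f g := by
  rwa [← show b = c from funext hbc]

theorem sub (hg : MulRel U b f g) (hh : MulRel U c f h) :
    MulRel U (fun x => b x - c x) f (g - h) := by
  unfold MulRel at *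
  rw [map_sub]
  filter_upwards [Lp.coeFn_sub (U g) (U h), hg, hh] with x h1 h2 h3
  rw [h1, Pi.sub_apply, h2, h3, sub_mul]

theorem smul (hg : MulRel U b f g) (z : ℂ) : MulRel U (fun x => z * b x) f (z • g) := by
  unfold MulRel at *
  rw [map_smul]
  filter_upwards [Lp.coeFn_smul z (U g), hg] with x h1 h2
  rw [h1, Pi.smul_apply, h2, smul_eq_mul, mul_assoc]

theorem neg (hg : MulRel U b f g) : MulRel U (fun x => -b x) f (-g) := by
  simpa using hg.smul (-1)

theorem refl (f : H) : MulRel U (fun _ => 1) f f := by simp [MulRel]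

theorem comp (hg : MulRel U b f g) (hh : MulRel U c g h) : MulRel U (fun x => c x * b x) f h := by
  unfold MulRel at *
  filter_upwards [hg, hh] with x h1 h2
  rw [h2, h1, mul_assoc]

theorem norm_le (hg : MulRel U b f g) {C : ℝ} (hC : ∀ x, ‖b x‖ ≤ C) : ‖g‖ ≤ C * ‖f‖ := by
  rw [← U.norm_map g, ← U.norm_map f]
  refine Lp.norm_le_mul_norm_of_ae_le_mul ?_
  filter_upwards [hg] with x h1
  rw [h1, norm_mul]
  gcongr
  exact hC x

theorem inner_eq (hg : MulRel U b f g) (h : H) :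
    inner ℂ h g = ∫ x, b x * (U f x * starRingEnd ℂ (U h x)) ∂μ := by
  rw [← U.inner_map_map, L2.inner_def]
  refine integral_congr_ae ?_
  filter_upwards [hg] with x h1
  rw [h1, RCLike.inner_apply, mul_assoc]

/-- Multiplication by a real function is symmetric. -/
theorem inner_comm {a : α → ℝ} {f' g' : H} (hg : MulRel U (fun x => (a x : ℂ)) f g)
    (hg' : MulRel U (fun x => (a x : ℂ)) f' g') : inner ℂ g f' = inner ℂ f g' := by
  rw [hg'.inner_eq, ← inner_conj_symm, hg.inner_eq, ← integral_conj]
  refine integral_congr_ae (Eventually.of_forall fun x => ?_)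
  simp only [map_mul, Complex.conj_ofReal, RingHomCompTriple.comp_apply, RingHom.id_apply]
  ring

theorem inner_nonneg {a : α → ℝ} (ha : ∀ x, 0 ≤ a x) (hg : MulRel U (fun x => (a x : ℂ)) f g) :
    0 ≤ (inner ℂ g f).re := by
  have h1 : inner ℂ f g = ((∫ x, a x * ‖U f x‖ ^ 2 ∂μ : ℝ) : ℂ) := by
    rw [hg.inner_eq, ← integral_complex_ofReal]
    refine integral_congr_ae (Eventually.of_forall fun x => ?_)
    simp only
    rw [Complex.mul_conj, Complex.normSq_eq_norm_sq, Complex.ofReal_mul]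
  rw [← inner_conj_symm, Complex.conj_re, h1, Complex.ofReal_re]
  exact integral_nonneg fun x => mul_nonneg (ha x) (sq_nonneg _)

/-- Dominated convergence for families of multipliers. -/
theorem tendsto {ι : Type*} {l : Filter ι} [l.IsCountablyGenerated] {m : ι → α → ℂ} {F : ι → H}
    {C : α → ℝ} (hF : ∀ i, MulRel U (m i) f (F i)) (hg : MulRel U b f g)
    (hC : MemLp (fun x => C x * ‖U f x‖) 2 μ) (hmC : ∀ᶠ i in l, ∀ x, ‖m i x‖ ≤ C x)
    (hbC : ∀ x, ‖b x‖ ≤ C x) (hm : ∀ x, Tendsto (fun i => m i x) l (𝓝 (b x))) :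
    Tendsto F l (𝓝 g) := by
  -- The multiplier identities hold only almost everywhere for each index; along a sequence the
  -- exceptional sets have a null union.
  refine tendsto_of_seq_tendsto fun s hs => ?_
  have h1 : Tendsto (fun i => U (F (s i))) atTop (𝓝 (U g)) := by
    have hall : ∀ᵐ x ∂μ, ∀ i, U (F (s i)) x = m (s i) x * U f x :=
      ae_all_iff.2 fun i => hF (s i)
    refine Lp.tendsto_two_of_dominated (hC.const_mul 2) ?_ ?_
    · filter_upwards [hs.eventually hmC] with i hi
      filter_upwards [hall, hg] with x hx hx'
      rw [hx i, hx', ← sub_mul, norm_mul]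
      calc ‖m (s i) x - b x‖ * ‖U f x‖ ≤ (C x + C x) * ‖U f x‖ := by
            gcongr
            exact (norm_sub_le _ _).trans (add_le_add (hi x) (hbC x))
        _ = 2 * (C x * ‖U f x‖) := by ring
    · filter_upwards [hall, hg] with x hx hx'
      rw [hx']
      simp only [hx]
      exact ((hm x).comp hs).mul_const _
  have h2 := (U.symm.continuous.tendsto _).comp h1
  simpa [Function.comp_def] using h2

theorem tendsto_of_bounded {ι : Type*} {l : Filter ι} [l.IsCountablyGenerated] {m : ι → α → ℂ}
    {F : ι → H} {C : ℝ} (hF : ∀ i, MulRel U (m i) f (F i)) (hg : MulRel U b f g)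
    (hmC : ∀ᶠ i in l, ∀ x, ‖m i x‖ ≤ C) (hbC : ∀ x, ‖b x‖ ≤ C)
    (hm : ∀ x, Tendsto (fun i => m i x) l (𝓝 (b x))) : Tendsto F l (𝓝 g) :=
  tendsto hF hg ((Lp.memLp (U f)).norm.const_mul C) hmC hbC hm

end MulRel

variable (U) in
/-- The bounded operator given by multiplication with an essentially bounded function. -/
def mulOp {b : α → ℂ} (hb : MemLp b ∞ μ) : H →L[ℂ] H :=
  (U.symm : Lp ℂ 2 μ →L[ℂ] H).comp
    (((ContinuousLinearMap.mul ℂ ℂ).holderL μ ∞ 2 2 hb.toLp).comp (U : H →L[ℂ] Lp ℂ 2 μ))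

theorem mulRel_mulOp {b : α → ℂ} (hb : MemLp b ∞ μ) (f : H) : MulRel U b f (mulOp U hb f) := by
  have h : U (mulOp U hb f) = (ContinuousLinearMap.mul ℂ ℂ).holder 2 hb.toLp (U f) := by
    simp [mulOp]
  unfold MulRel
  rw [h]
  filter_upwards [(ContinuousLinearMap.mul ℂ ℂ).coeFn_holder (r := 2) hb.toLp (U f),
    hb.coeFn_toLp] with x h1 h2
  rw [h1, h2, ContinuousLinearMap.mul_apply']

variable (U) in
/-- The graph of the maximal operator of multiplication with a real function. -/
def multiplierGraph (a : α → ℝ) : Submodule ℂ (H × H) where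
  carrier := {z | MulRel U (fun x => (a x : ℂ)) z.1 z.2}
  zero_mem' := by
    change MulRel U (fun x => (a x : ℂ)) (0 : H) (0 : H)
    unfold MulRel
    rw [map_zero]
    filter_upwards [Lp.coeFn_zero ℂ 2 μ] with x hx
    rw [hx, Pi.zero_apply, mul_zero]
  add_mem' := fun {z z'} h h' => by
    have h : MulRel U (fun x => (a x : ℂ)) z.1 z.2 := h
    have h' : MulRel U (fun x => (a x : ℂ)) z'.1 z'.2 := h'
    change MulRel U (fun x => (a x : ℂ)) (z.1 + z'.1) (z.2 + z'.2)
    unfold MulRel at *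
    rw [map_add, map_add]
    filter_upwards [Lp.coeFn_add (U z.1) (U z'.1), Lp.coeFn_add (U z.2) (U z'.2), h, h']
      with x h1 h2 h3 h4
    rw [h1, h2, Pi.add_apply, Pi.add_apply, h3, h4, mul_add]
  smul_mem' := fun c z h => by
    have h : MulRel U (fun x => (a x : ℂ)) z.1 z.2 := h
    change MulRel U (fun x => (a x : ℂ)) (c • z.1) (c • z.2)
    unfold MulRel at *
    rw [map_smul, map_smul]
    filter_upwards [Lp.coeFn_smul c (U z.1), Lp.coeFn_smul c (U z.2), h] with x h1 h2 h3
    rw [h1, h2, Pi.smul_apply, Pi.smul_apply, h3, smul_eq_mul, smul_eq_mul, mul_left_comm]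

variable (U) in
/-- The maximal operator of multiplication with a real function. -/
def multiplier (a : α → ℝ) : H →ₗ.[ℂ] H := (multiplierGraph U a).toLinearPMap

variable {a : α → ℝ}

theorem mem_graph_multiplier {f g : H} :
    (f, g) ∈ (multiplier U a).graph ↔ MulRel U (fun x => (a x : ℂ)) f g := by
  rw [multiplier, Submodule.toLinearPMap_graph_eq]
  · rfl
  · rintro ⟨f, g⟩ hz rfl
    have hz : MulRel U (fun x => (a x : ℂ)) 0 g := hz
    exact hz.unique ((multiplierGraph U a).zero_mem)

theorem mulRel_multiplier (f : (multiplier U a).domain) :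
    MulRel U (fun x => (a x : ℂ)) f (multiplier U a f) :=
  mem_graph_multiplier.1 (LinearPMap.mem_graph _ f)

theorem exists_multiplier_eq_iff {f g : H} :
    (∃ hf : f ∈ (multiplier U a).domain, multiplier U a ⟨f, hf⟩ = g) ↔
      MulRel U (fun x => (a x : ℂ)) f g := by
  rw [← mem_graph_multiplier, LinearPMap.mem_graph_iff]
  constructor
  · rintro ⟨hf, rfl⟩
    exact ⟨⟨f, hf⟩, rfl, rfl⟩
  · rintro ⟨⟨y, hy⟩, rfl, h⟩
    exact ⟨hy, h⟩

theorem MulRel.mem_domain {f g : H} (h : MulRel U (fun x => (a x : ℂ)) f g) :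
    f ∈ (multiplier U a).domain :=
  (exists_multiplier_eq_iff.2 h).1

theorem mem_domain_multiplier {f : H} :
    f ∈ (multiplier U a).domain ↔ MemLp (fun x => (a x : ℂ) * U f x) 2 μ := by
  refine ⟨fun h => (mulRel_multiplier ⟨f, h⟩).memLp, fun h =>
    MulRel.mem_domain (g := U.symm h.toLp) ?_⟩
  unfold MulRel
  rw [U.apply_symm_apply]
  exact MemLp.coeFn_toLp h

/-! ### Resolvents and self-adjointness -/

section Resolvent

theorem norm_resolvent_le {α : Type*} {a : α → ℝ} (ha0 : ∀ x, 0 ≤ a x) {t : ℝ} (ht : 0 ≤ t)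
    (x : α) : ‖(((1 + t * a x)⁻¹ : ℝ) : ℂ)‖ ≤ 1 := by
  have := mul_nonneg ht (ha0 x)
  rw [Complex.norm_real, Real.norm_of_nonneg (by positivity)]
  exact inv_le_one_of_one_le₀ (by linarith)

theorem memLp_resolvent (ha : Measurable a) (ha0 : ∀ x, 0 ≤ a x) {t : ℝ} (ht : 0 ≤ t) :
    MemLp (fun x => (((1 + t * a x)⁻¹ : ℝ) : ℂ)) ∞ μ :=
  memLp_top_of_bound (Complex.measurable_ofReal.comp
    (measurable_const.add (measurable_const.mul ha)).inv).aestronglyMeasurable 1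
    (Eventually.of_forall (norm_resolvent_le ha0 ht))

theorem norm_mul_resolvent_le {α : Type*} {a : α → ℝ} (ha0 : ∀ x, 0 ≤ a x) {t : ℝ} (ht : 0 < t)
    (x : α) : ‖(((a x * (1 + t * a x)⁻¹ : ℝ)) : ℂ)‖ ≤ t⁻¹ := by
  have h0 := ha0 x
  have := mul_nonneg ht.le (ha0 x)
  rw [Complex.norm_real, Real.norm_of_nonneg (by positivity), ← div_eq_mul_inv,
    div_le_iff₀ (by positivity), mul_add, inv_mul_cancel_left₀ ht.ne']
  have : 0 ≤ t⁻¹ := by positivity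
  linarith

theorem memLp_mul_resolvent (ha : Measurable a) (ha0 : ∀ x, 0 ≤ a x) {t : ℝ} (ht : 0 < t) :
    MemLp (fun x => ((a x * (1 + t * a x)⁻¹ : ℝ) : ℂ)) ∞ μ :=
  memLp_top_of_bound (Complex.measurable_ofReal.comp
    (ha.mul (measurable_const.add (measurable_const.mul ha)).inv)).aestronglyMeasurable t⁻¹
    (Eventually.of_forall (norm_mul_resolvent_le ha0 ht))

/-- Since both multipliers are bounded, the resolvent maps all of `H` into the domain. This supplies
the vectors used for density and for testing the adjoint. -/
theorem mulRel_multiplier_resolvent (ha : Measurable a) (ha0 : ∀ x, 0 ≤ a x) {t : ℝ}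
    (ht : 0 < t) (f : H) :
    MulRel U (fun x => (a x : ℂ)) (mulOp U (memLp_resolvent ha ha0 ht.le) f)
      (mulOp U (memLp_mul_resolvent ha ha0 ht) f) := by
  unfold MulRel
  filter_upwards [mulRel_mulOp (U := U) (memLp_resolvent ha ha0 ht.le) f,
    mulRel_mulOp (U := U) (memLp_mul_resolvent ha ha0 ht) f] with x h1 h2
  rw [h1, h2]
  push_cast
  ring

theorem dense_domain_multiplier (ha : Measurable a) (ha0 : ∀ x, 0 ≤ a x) :
    Dense ((multiplier U a).domain : Set H) := by
  intro f
  have ht : ∀ k : ℕ, (0 : ℝ) < 1 / ((k : ℝ) + 1) := fun k => by positivity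
  -- The vectors `(1 + t a)⁻¹ f` with `t = 1 / (k + 1)` lie in the domain and tend to `f` by
  -- dominated convergence.
  refine mem_closure_of_tendsto (b := atTop)
    (f := fun k : ℕ => mulOp U (memLp_resolvent (μ := μ) ha ha0 (ht k).le) f) ?_
    (Eventually.of_forall fun k => (mulRel_multiplier_resolvent ha ha0 (ht k) f).mem_domain)
  refine MulRel.tendsto_of_bounded (C := 1) (fun k => mulRel_mulOp _ f) (MulRel.refl f)
    (Eventually.of_forall fun k => norm_resolvent_le ha0 (ht k).le) (by simp) fun x => ?_
  have h1 : Tendsto (fun k : ℕ => (1 + 1 / ((k : ℝ) + 1) * a x)⁻¹) atTop (𝓝 (1 + 0 * a x)⁻¹) :=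
    (tendsto_const_nhds.add (tendsto_one_div_add_atTop_nhds_zero_nat.mul_const _)).inv₀ (by simp)
  have h2 := (Complex.continuous_ofReal.tendsto _).comp h1
  simpa [Function.comp_def] using h2

/-- The resolvent at `-1` detects the relation `g = a f`. -/
theorem mulRel_of_resolvent (ha : Measurable a) (ha0 : ∀ x, 0 ≤ a x) {f g : H}
    (h : mulOp U (memLp_resolvent (μ := μ) ha ha0 zero_le_one) g =
      mulOp U (memLp_mul_resolvent (μ := μ) ha ha0 one_pos) f) :
    MulRel U (fun x => (a x : ℂ)) f g := by
  have h1 := mulRel_mulOp (U := U) (memLp_resolvent ha ha0 zero_le_one) g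
  rw [h] at h1
  have h2 := mulRel_mulOp (U := U) (memLp_mul_resolvent ha ha0 one_pos) f
  unfold MulRel at *
  filter_upwards [h1, h2] with x h3 h4
  rw [h3] at h4
  have h5 : ((1 + a x : ℝ) : ℂ) ≠ 0 := by
    have := ha0 x
    exact_mod_cast (by positivity : (1 + a x : ℝ) ≠ 0)
  push_cast at h4 h5
  rw [one_mul] at h4
  field_simp at h4
  exact h4

variable [CompleteSpace H]

/-- Symmetry gives one inclusion. For `y` in the adjoint domain, testing against the domain vectors
`(1 + a)⁻¹ h` with arbitrary `h` yields `(1 + a)⁻¹ A* y = a (1 + a)⁻¹ y`, that is `A* y = a y`. -/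
theorem isSelfAdjoint_multiplier (ha : Measurable a) (ha0 : ∀ x, 0 ≤ a x) :
    IsSelfAdjoint (multiplier U a) := by
  have hd := dense_domain_multiplier (U := U) ha ha0
  have hle : multiplier U a ≤ (multiplier U a).adjoint :=
    LinearPMap.IsFormalAdjoint.le_adjoint hd fun f g =>
      (mulRel_multiplier f).inner_comm (mulRel_multiplier g)
  rw [LinearPMap.isSelfAdjoint_def]
  refine (LinearPMap.eq_of_le_of_domain_eq hle (le_antisymm hle.1 fun y hy => ?_)).symm
  have h1 : MulRel U (fun x => (a x : ℂ)) y ((multiplier U a).adjoint ⟨y, hy⟩) := by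
    refine mulRel_of_resolvent ha ha0 (ext_inner_right ℂ fun h => ?_)
    obtain ⟨hf, he⟩ := exists_multiplier_eq_iff.2
      (mulRel_multiplier_resolvent (U := U) ha ha0 one_pos h)
    have h2 := LinearPMap.adjoint_isFormalAdjoint hd ⟨y, hy⟩ ⟨_, hf⟩
    rw [he] at h2
    rw [(mulRel_mulOp (memLp_resolvent ha ha0 zero_le_one) _).inner_comm
      (mulRel_mulOp (memLp_resolvent ha ha0 zero_le_one) h), h2]
    exact ((mulRel_mulOp (memLp_mul_resolvent ha ha0 one_pos) y).inner_comm
      (mulRel_mulOp (memLp_mul_resolvent ha ha0 one_pos) h)).symm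
  exact h1.mem_domain

end Resolvent

end SpectralMultiplier
end

noncomputable section

/-! ### The holomorphic semigroup `exp (-z a)` -/

namespace SpectralMultiplier

variable {α : Type*} [MeasurableSpace α] {μ : Measure α}
  {H : Type*} [NormedAddCommGroup H] [InnerProductSpace ℂ H]
  {U : H ≃ₗᵢ[ℂ] Lp ℂ 2 μ} {a : α → ℝ}

/-- The function `exp (-z a)`, where `z` is first projected to the closed right half-plane. -/
def expMultiplier (a : α → ℝ) (z : ℂ) (x : α) : ℂ :=
  Complex.exp (-(((max z.re 0 : ℝ) : ℂ) + z.im * Complex.I) * a x)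

theorem expMultiplier_eq {α : Type*} (a : α → ℝ) {z : ℂ} (hz : 0 ≤ z.re) (x : α) :
    expMultiplier a z x = Complex.exp (-z * a x) := by
  rw [expMultiplier, max_eq_left hz, Complex.re_add_im]

theorem norm_expMultiplier_le {α : Type*} {a : α → ℝ} (ha0 : ∀ x, 0 ≤ a x) (z : ℂ) (x : α) :
    ‖expMultiplier a z x‖ ≤ 1 := by
  rw [expMultiplier, Complex.norm_exp, Real.exp_le_one_iff]
  have : (-(((max z.re 0 : ℝ) : ℂ) + z.im * Complex.I) * a x).re = -(max z.re 0) * a x := by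
    simp
  rw [this, neg_mul, neg_nonpos]
  exact mul_nonneg (le_max_right _ _) (ha0 x)

theorem continuous_expMultiplier {α : Type*} (a : α → ℝ) (x : α) :
    Continuous fun z => expMultiplier a z x := by
  unfold expMultiplier
  fun_prop

theorem memLp_expMultiplier (ha : Measurable a) (ha0 : ∀ x, 0 ≤ a x) (z : ℂ) :
    MemLp (expMultiplier a z) ∞ μ :=
  memLp_top_of_bound (Complex.continuous_exp.measurable.comp
    (measurable_const.mul (Complex.measurable_ofReal.comp ha))).aestronglyMeasurable 1
    (Eventually.of_forall (norm_expMultiplier_le ha0 z))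

variable (U) in
/-- The family of operators `exp (-z a)`. -/
def expOp (ha : Measurable a) (ha0 : ∀ x, 0 ≤ a x) (z : ℂ) : H →L[ℂ] H :=
  mulOp U (memLp_expMultiplier ha ha0 z)

variable (ha : Measurable a) (ha0 : ∀ x, 0 ≤ a x)

theorem mulRel_expOp (z : ℂ) (f : H) : MulRel U (expMultiplier a z) f (expOp U ha ha0 z f) :=
  mulRel_mulOp _ f

theorem norm_expOp_le (z : ℂ) : ‖expOp U ha ha0 z‖ ≤ 1 :=
  ContinuousLinearMap.opNorm_le_bound _ zero_le_one fun f =>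
    (mulRel_expOp ha ha0 z f).norm_le (norm_expMultiplier_le ha0 z)

theorem expOp_add {z₁ z₂ : ℂ} (h₁ : 0 ≤ z₁.re) (h₂ : 0 ≤ z₂.re) :
    expOp U ha ha0 (z₁ + z₂) = (expOp U ha ha0 z₁).comp (expOp U ha ha0 z₂) := by
  refine ContinuousLinearMap.ext fun f => (mulRel_expOp ha ha0 _ f).unique
    (((mulRel_expOp ha ha0 z₂ f).comp (mulRel_expOp ha ha0 z₁ _)).congr fun x => ?_)
  rw [expMultiplier_eq a h₁, expMultiplier_eq a h₂,
    expMultiplier_eq a (by rw [Complex.add_re]; exact add_nonneg h₁ h₂), ← Complex.exp_add]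
  congr 1
  ring

theorem expOp_zero : expOp U ha ha0 0 = ContinuousLinearMap.id ℂ H :=
  ContinuousLinearMap.ext fun f => (mulRel_expOp ha ha0 0 f).unique
    ((MulRel.refl f).congr fun x => by simp [expMultiplier])

theorem continuous_expOp (f : H) : Continuous fun z => expOp U ha ha0 z f :=
  continuous_iff_continuousAt.2 fun z => MulRel.tendsto_of_bounded (C := 1)
    (fun z => mulRel_expOp ha ha0 z f) (mulRel_expOp ha ha0 z f)
    (Eventually.of_forall fun z => norm_expMultiplier_le ha0 z) (norm_expMultiplier_le ha0 z)
    fun x => (continuous_expMultiplier a x).tendsto z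

theorem isC0Semigroup_expOp : IsC0Semigroup fun t : ℝ≥0 => expOp U ha ha0 ((t : ℝ) : ℂ) where
  map_zero := by simpa using expOp_zero ha ha0
  map_add s t := by
    rw [NNReal.coe_add, Complex.ofReal_add]
    exact expOp_add ha ha0 (by simp) (by simp)
  continuous f := (continuous_expOp ha ha0 f).comp
    (Complex.continuous_ofReal.comp NNReal.continuous_coe)

/-- The difference quotient of `exp (-t a)` at `t = 0`. -/
theorem norm_expMultiplier_sub_one_le {α : Type*} {a : α → ℝ} (ha0 : ∀ x, 0 ≤ a x) {t : ℝ}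
    (ht : 0 ≤ t) (x : α) : ‖(t⁻¹ : ℂ) * (expMultiplier a t x - 1)‖ ≤ a x := by
  have h1 : (t⁻¹ : ℂ) * (expMultiplier a t x - 1) =
      ((t⁻¹ * (Real.exp (-t * a x) - 1) : ℝ) : ℂ) := by
    rw [expMultiplier_eq a (by simpa using ht)]
    push_cast
    rfl
  have h2 := mul_nonneg ht (ha0 x)
  have h3 : Real.exp (-t * a x) ≤ 1 := Real.exp_le_one_iff.2 (by linarith)
  have h4 := Real.add_one_le_exp (-t * a x)
  rw [h1, Complex.norm_real, norm_mul, norm_inv, Real.norm_of_nonneg ht, Real.norm_eq_abs,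
    abs_of_nonpos (by linarith)]
  rcases ht.eq_or_lt with rfl | ht'
  · simpa using ha0 x
  · rw [inv_mul_le_iff₀ ht']
    linarith

theorem tendsto_expMultiplier_sub_one {α : Type*} (a : α → ℝ) (x : α) :
    Tendsto (fun t : ℝ≥0 => ((t : ℝ)⁻¹ : ℂ) * (expMultiplier a (t : ℝ) x - 1)) (𝓝[>] 0)
      (𝓝 (-(a x : ℂ))) := by
  have h1 : HasDerivAt (fun t : ℝ => Complex.exp (-(t : ℂ) * a x)) (-(a x : ℂ)) 0 := by
    have h2 : HasDerivAt (fun t : ℝ => -(t : ℂ) * a x) (-1 * a x) 0 :=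
      (((hasDerivAt_id (0 : ℝ)).ofReal_comp).neg).mul_const _
    simpa using h2.cexp
  have h3 := hasDerivAt_iff_tendsto_slope_zero.1 h1
  have h4 : Tendsto (fun t : ℝ≥0 => (t : ℝ)) (𝓝[>] 0) (𝓝[≠] 0) := by
    refine tendsto_nhdsWithin_iff.2 ⟨(NNReal.continuous_coe.tendsto 0).mono_left
      nhdsWithin_le_nhds, ?_⟩
    filter_upwards [self_mem_nhdsWithin] with t ht
    exact (NNReal.coe_pos.2 ht).ne'
  refine (h3.comp h4).congr fun t => ?_
  rw [expMultiplier_eq a (by simp)]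
  simp

theorem mulRel_differenceQuotient (t : ℝ≥0) (f : H) :
    MulRel U (fun x => ((t : ℝ)⁻¹ : ℂ) * (expMultiplier a (t : ℝ) x - 1)) f
      (((t : ℝ)⁻¹ : ℂ) • (expOp U ha ha0 ((t : ℝ) : ℂ) f - f)) :=
  ((mulRel_expOp ha ha0 _ f).sub (MulRel.refl f)).smul _

theorem mem_graph_neg_multiplier {f g : H} :
    (f, g) ∈ (-multiplier U a).graph ↔ MulRel U (fun x => (a x : ℂ)) f (-g) := by
  rw [← exists_multiplier_eq_iff, LinearPMap.mem_graph_iff]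
  constructor
  · rintro ⟨y, rfl, rfl⟩
    exact ⟨y.2, by simp⟩
  · rintro ⟨hf, h⟩
    exact ⟨⟨f, hf⟩, rfl, by rw [LinearPMap.neg_apply, h, neg_neg]⟩

/-- On the domain the difference quotients are dominated by `a`, so they converge. Conversely, a
limit `g` may exist without `f` being known to lie in the domain; applying `(1 + a)⁻¹` makes the
quotients bounded by `1`, identifies their limit as `-a (1 + a)⁻¹ f`, and `mulRel_of_resolvent`
recovers the graph relation. -/
theorem isGenerator_expOp :
    IsGenerator (-multiplier U a) fun t : ℝ≥0 => expOp U ha ha0 ((t : ℝ) : ℂ) := by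
  intro f g
  rw [mem_graph_neg_multiplier]
  constructor
  · intro h
    have h' : MulRel U (fun x => -(a x : ℂ)) f g := by simpa using h.neg
    refine MulRel.tendsto (C := a) (mulRel_differenceQuotient ha ha0 · f) h' ?_
      (Eventually.of_forall fun t x => norm_expMultiplier_sub_one_le ha0 t.2 x)
      (fun x => by rw [norm_neg, Complex.norm_real, Real.norm_of_nonneg (ha0 x)])
      (tendsto_expMultiplier_sub_one a)
    refine h.memLp.norm.ae_eq (Eventually.of_forall fun x => ?_)
    simp only [norm_mul, Complex.norm_real, Real.norm_of_nonneg (ha0 x)]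
  · intro h
    set R := mulOp U (memLp_resolvent (μ := μ) ha ha0 zero_le_one) with hR
    have h1 := (R.continuous.tendsto g).comp h
    have h2 : Tendsto (fun t : ℝ≥0 =>
        R (((t : ℝ)⁻¹ : ℂ) • (expOp U ha ha0 ((t : ℝ) : ℂ) f - f))) (𝓝[>] 0)
        (𝓝 (-mulOp U (memLp_mul_resolvent (μ := μ) ha ha0 one_pos) f)) := by
      refine MulRel.tendsto_of_bounded (C := 1)
        (fun t => (mulRel_differenceQuotient ha ha0 t f).comp (mulRel_mulOp _ _))
        (mulRel_mulOp (memLp_mul_resolvent ha ha0 one_pos) f).neg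
        (Eventually.of_forall fun t x => ?_) (fun x => ?_) fun x => ?_
      · have h3 := norm_mul_resolvent_le ha0 one_pos x
        refine le_trans ?_ (h3.trans_eq inv_one)
        rw [norm_mul, mul_comm, Complex.ofReal_mul, norm_mul (a x : ℂ), Complex.norm_real (a x),
          Real.norm_of_nonneg (ha0 x)]
        gcongr
        exact norm_expMultiplier_sub_one_le ha0 t.2 x
      · rw [norm_neg]
        exact (norm_mul_resolvent_le ha0 one_pos x).trans_eq inv_one
      · have := (tendsto_expMultiplier_sub_one a x).const_mul (((1 + 1 * a x)⁻¹ : ℝ) : ℂ)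
        convert! this using 2
        push_cast
        ring
    refine mulRel_of_resolvent ha ha0 ?_
    rw [map_neg, tendsto_nhds_unique h1 h2, neg_neg]

/-- A second-order Taylor bound uniform in `t ≥ 0`, which gives differentiability in operator norm.
The decay `exp (-r t)` pays half for the remainder factor `exp (‖h‖ t)` and half for `t ^ 2`. -/
theorem norm_exp_sub_linear_le {t r : ℝ} (ht : 0 ≤ t) (hr : 0 < r) {z h : ℂ} (hz : r ≤ z.re)
    (hh : ‖h‖ ≤ r / 2) :
    ‖Complex.exp (-(z + h) * t) - Complex.exp (-z * t) - h * (-t * Complex.exp (-z * t))‖ ≤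
      16 / r ^ 2 * ‖h‖ ^ 2 := by
  have h1 : Complex.exp (-(z + h) * t) - Complex.exp (-z * t) -
      h * (-t * Complex.exp (-z * t)) =
      Complex.exp (-z * t) * (Complex.exp (-h * t) -
        ∑ m ∈ Finset.range 2, (-h * t) ^ m / (m.factorial : ℂ)) := by
    rw [show -(z + h) * t = -z * t + -h * t by ring, Complex.exp_add]
    simp [Finset.sum_range_succ]
    ring
  have h2 := Complex.norm_exp_sub_sum_le_norm_mul_exp (-h * t) 2
  have h3 : ‖-h * (t : ℂ)‖ = ‖h‖ * t := by
    rw [norm_mul, norm_neg, Complex.norm_real, Real.norm_of_nonneg ht]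
  rw [h3] at h2
  have h4 : ‖Complex.exp (-z * t)‖ ≤ Real.exp (-r * t) := by
    rw [Complex.norm_exp]
    refine Real.exp_le_exp.2 ?_
    simp only [neg_mul, Complex.neg_re, Complex.re_mul_ofReal]
    gcongr
  have h5 : Real.exp (‖h‖ * t) ≤ Real.exp (r / 2 * t) := Real.exp_le_exp.2 (by gcongr)
  -- The constant `16` arises from squaring `r t / 4 ≤ exp (r t / 4)`, which leaves exactly the
  -- growth `exp (r t / 2)`.
  have h6 : t ^ 2 ≤ 16 / r ^ 2 * Real.exp (r / 2 * t) := by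
    have h7 : r / 4 * t ≤ Real.exp (r / 4 * t) :=
      (by linarith : r / 4 * t ≤ r / 4 * t + 1).trans (Real.add_one_le_exp _)
    have h8 : (r / 4 * t) ^ 2 ≤ Real.exp (r / 4 * t) ^ 2 := by gcongr
    rw [← Real.exp_nat_mul, show ((2 : ℕ) : ℝ) * (r / 4 * t) = r / 2 * t by push_cast; ring] at h8
    calc t ^ 2 = 16 / r ^ 2 * (r / 4 * t) ^ 2 := by field_simp; norm_num
      _ ≤ _ := by gcongr
  rw [h1, norm_mul]
  calc ‖Complex.exp (-z * t)‖ * ‖Complex.exp (-h * t) -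
        ∑ m ∈ Finset.range 2, (-h * t) ^ m / (m.factorial : ℂ)‖
      ≤ Real.exp (-r * t) * ((‖h‖ * t) ^ 2 * Real.exp (r / 2 * t)) := by
        gcongr
        exact h2.trans (by gcongr)
    _ = t ^ 2 * (‖h‖ ^ 2 * (Real.exp (-r * t) * Real.exp (r / 2 * t))) := by ring
    _ ≤ 16 / r ^ 2 * Real.exp (r / 2 * t) *
        (‖h‖ ^ 2 * (Real.exp (-r * t) * Real.exp (r / 2 * t))) := by gcongr
    _ = 16 / r ^ 2 * ‖h‖ ^ 2 *
        (Real.exp (r / 2 * t) * Real.exp (-r * t) * Real.exp (r / 2 * t)) := by ring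
    _ = 16 / r ^ 2 * ‖h‖ ^ 2 := by
        rw [← Real.exp_add, ← Real.exp_add, show r / 2 * t + -r * t + r / 2 * t = 0 by ring,
          Real.exp_zero, mul_one]

theorem norm_mul_exp_le {t r : ℝ} (ht : 0 ≤ t) (hr : 0 < r) {z : ℂ} (hz : r ≤ z.re) :
    ‖-(t : ℂ) * Complex.exp (-z * t)‖ ≤ r⁻¹ := by
  have h4 : ‖Complex.exp (-z * t)‖ ≤ Real.exp (-(r * t)) := by
    rw [Complex.norm_exp]
    refine Real.exp_le_exp.2 ?_
    simp only [neg_mul, Complex.neg_re, Complex.re_mul_ofReal]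
    gcongr
  rw [norm_mul, norm_neg, Complex.norm_real, Real.norm_of_nonneg ht]
  have h5 : r * t ≤ Real.exp (r * t) :=
    (by linarith : r * t ≤ r * t + 1).trans (Real.add_one_le_exp _)
  calc t * ‖Complex.exp (-z * t)‖ ≤ r⁻¹ * Real.exp (r * t) * Real.exp (-(r * t)) := by
        gcongr
        rwa [le_inv_mul_iff₀ hr]
    _ = r⁻¹ := by rw [mul_assoc, ← Real.exp_add, add_neg_cancel, Real.exp_zero, mul_one]

theorem differentiableAt_expOp {z : ℂ} (hz : 0 < z.re) :
    DifferentiableAt ℂ (expOp U ha ha0) z := by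
  have hm : MemLp (fun x => -(a x : ℂ) * Complex.exp (-z * a x)) ∞ μ :=
    memLp_top_of_bound (((Complex.measurable_ofReal.comp ha).neg).mul
      (Complex.continuous_exp.measurable.comp (measurable_const.mul
        (Complex.measurable_ofReal.comp ha)))).aestronglyMeasurable (z.re)⁻¹
      (Eventually.of_forall fun x => norm_mul_exp_le (ha0 x) hz le_rfl)
  refine HasDerivAt.differentiableAt (f' := mulOp U hm) ?_
  rw [hasDerivAt_iff_isLittleO_nhds_zero]
  have hO : (fun h => expOp U ha ha0 (z + h) - expOp U ha ha0 z - h • mulOp U hm) =O[𝓝 0]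
      fun h => ‖h‖ ^ 2 := by
    refine Asymptotics.IsBigO.of_bound (16 / z.re ^ 2) ?_
    -- The radius `Re z / 2` keeps `z + h` in the right half-plane, where the projection inside
    -- `expMultiplier` is inactive.
    filter_upwards [Metric.closedBall_mem_nhds (0 : ℂ) (half_pos hz)] with h hh
    rw [mem_closedBall_zero_iff] at hh
    rw [norm_pow, norm_norm]
    refine ContinuousLinearMap.opNorm_le_bound _ (by positivity) fun f => ?_
    have hre : 0 ≤ (z + h).re := by
      rw [Complex.add_re]
      have := (abs_le.1 (Complex.abs_re_le_norm h)).1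
      linarith
    refine (((mulRel_expOp ha ha0 (z + h) f).sub (mulRel_expOp ha ha0 z f)).sub
      ((mulRel_mulOp hm f).smul h)).norm_le fun x => ?_
    rw [expMultiplier_eq a hre, expMultiplier_eq a hz.le]
    exact norm_exp_sub_linear_le (ha0 x) hz le_rfl hh
  refine hO.trans_isLittleO ?_
  exact ((Asymptotics.isLittleO_pow_id (𝕜 := ℝ) one_lt_two).comp_tendsto
    (tendsto_norm_zero (E := ℂ))).of_norm_right

theorem re_pos_of_mem_sector {z : ℂ} (hz : z ∈ sector (Real.pi / 2)) : 0 < z.re :=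
  (Complex.abs_arg_lt_pi_div_two_iff.1 hz.2).resolve_right hz.1

theorem isBoundedHolomorphic_expOp :
    IsBoundedHolomorphic (fun t : ℝ≥0 => expOp U ha ha0 ((t : ℝ) : ℂ)) (Real.pi / 2) := by
  refine ⟨expOp U ha ha0, fun t => rfl, fun z₁ h₁ z₂ h₂ => expOp_add ha ha0
    (re_pos_of_mem_sector h₁).le (re_pos_of_mem_sector h₂).le,
    fun z hz => (differentiableAt_expOp ha ha0 (re_pos_of_mem_sector hz)).differentiableWithinAt,
    fun δ' _ _ => ⟨fun f => ?_, 1, fun z _ => norm_expOp_le ha ha0 z⟩⟩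
  have h := (continuous_expOp (U := U) ha ha0 f).tendsto 0
  rw [expOp_zero] at h
  exact h.mono_left nhdsWithin_le_nhds

end SpectralMultiplier
end

noncomputable section

/-! ### The realization of `W` in `L²` -/

namespace PadicNonlocal

variable {p : ℕ} [Fact p.Prime] {n : ℕ} {w : Qpn p n → ℝ}

theorem IsTestFunction.isFourierL2 {φ : Qpn p n → ℂ} (hφ : IsTestFunction φ) :
    IsFourierL2 φ (PadicNonlocal.fourierIntegral φ) :=
  ⟨hφ.memLp 2, hφ.fourierIntegral.memLp 2, fun _ hψ =>
    integral_fourierIntegral_mul hφ.integrable hψ.integrable⟩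

/-- The real-valued multiplier `κ A_w`. -/
def realSymbol (κ : ℝ) (w : Qpn p n → ℝ) (ξ : Qpn p n) : ℝ := κ * (symbolA w ξ).re

theorem ofReal_realSymbol (hw : IsAdmissible w) (κ : ℝ) (ξ : Qpn p n) :
    (realSymbol κ w ξ : ℂ) = κ * symbolA w ξ := by
  rw [symbolA_eq_ofReal hw, realSymbol, Complex.ofReal_mul]

theorem measurable_realSymbol (hw : IsAdmissible w) (κ : ℝ) : Measurable (realSymbol κ w) :=
  (Complex.measurable_re.comp (stronglyMeasurable_symbolA hw).measurable).const_mul κ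

theorem realSymbol_nonneg (hw : IsAdmissible w) {κ : ℝ} (hκ : 0 ≤ κ) (ξ : Qpn p n) :
    0 ≤ realSymbol κ w ξ :=
  mul_nonneg hκ (symbolA_re_nonneg hw ξ)

/-- The realization of the nonlocal operator in `L²`. -/
def nonlocalL2 (κ : ℝ) (w : Qpn p n → ℝ) : L2 p n →ₗ.[ℂ] L2 p n :=
  -SpectralMultiplier.multiplier (fourierL2 p n) (realSymbol κ w)

theorem mem_graph_nonlocalL2 (hw : IsAdmissible w) {κ : ℝ} {f g : L2 p n} :
    (f, g) ∈ (nonlocalL2 κ w).graph ↔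
      fourierL2 p n g =ᵐ[haar p n] fun ξ => -(κ : ℂ) * (symbolA w ξ * fourierL2 p n f ξ) := by
  rw [nonlocalL2, SpectralMultiplier.mem_graph_neg_multiplier, SpectralMultiplier.MulRel, map_neg]
  simp only [ofReal_realSymbol hw]
  constructor <;> intro h
  all_goals
    filter_upwards [h, Lp.coeFn_neg (fourierL2 p n g)] with ξ h1 h2
    rw [Pi.neg_apply] at h2
  · rw [h2] at h1
    linear_combination -h1
  · rw [h2, h1]
    ring

theorem mem_domain_nonlocalL2 (hw : IsAdmissible w) {κ : ℝ} (hκ : 0 < κ) {f : L2 p n} :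
    f ∈ (nonlocalL2 κ w).domain ↔ ∃ g : Qpn p n → ℂ,
      IsFourierL2 f g ∧ MemLp (fun ξ => symbolA w ξ * g ξ) 2 (haar p n) := by
  have hκ' : (κ : ℂ) ≠ 0 := by exact_mod_cast hκ.ne'
  have h1 : f ∈ (nonlocalL2 κ w).domain ↔
      MemLp (fun ξ => symbolA w ξ * fourierL2 p n f ξ) 2 (haar p n) := by
    rw [nonlocalL2, LinearPMap.neg_domain, SpectralMultiplier.mem_domain_multiplier]
    simp only [ofReal_realSymbol hw, mul_assoc]
    refine ⟨fun h => ?_, fun h => h.const_mul _⟩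
    -- Here `κ ≠ 0` is essential: the multiplier is `κ A_w`, while the domain is described by `A_w`
    -- alone.
    simpa [inv_mul_cancel_left₀ hκ'] using h.const_mul ((κ : ℂ)⁻¹)
  rw [h1]
  refine ⟨fun h => ⟨_, isFourierL2_fourierL2 f, h⟩, ?_⟩
  rintro ⟨g, hg, h⟩
  exact h.ae_eq ((ae_eq_refl (symbolA w)).mul (isFourierL2_iff.1 hg))

theorem nonlocalL2_extends (hw : IsAdmissible w) (κ : ℝ) {φ : Qpn p n → ℂ}
    (hφ : IsTestFunction φ) {f : L2 p n} (hf : f =ᵐ[haar p n] φ) :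
    ∃ hf : f ∈ (nonlocalL2 κ w).domain,
      nonlocalL2 κ w ⟨f, hf⟩ =ᵐ[haar p n] nonlocalOp κ w φ := by
  have hW := isFourierL2_nonlocalOp hw κ hφ
  have hU : fourierL2 p n f =ᵐ[haar p n] fourierIntegral φ :=
    (isFourierL2_iff.1 (hφ.isFourierL2.congr hf.symm (ae_eq_refl _))).symm
  have hg := isFourierL2_iff.1 (hW.congr (hW.1.coeFn_toLp).symm (ae_eq_refl _))
  have hgraph : (f, hW.1.toLp) ∈ (nonlocalL2 κ w).graph := by
    rw [mem_graph_nonlocalL2 hw]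
    filter_upwards [hg, hU] with ξ h1 h2
    rw [← h1, h2]
  obtain ⟨y, rfl, hy⟩ := (LinearPMap.mem_graph_iff _).1 hgraph
  refine ⟨y.2, ?_⟩
  rw [Subtype.coe_eta, hy]
  exact hW.1.coeFn_toLp

theorem isFourierL2_nonlocalL2 (hw : IsAdmissible w) {κ : ℝ} (f : (nonlocalL2 κ w).domain)
    {g : Qpn p n → ℂ} (hg : IsFourierL2 (f : L2 p n) g) :
    IsFourierL2 (nonlocalL2 κ w f) fun ξ => -(κ : ℂ) * (symbolA w ξ * g ξ) := by
  rw [isFourierL2_iff]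
  filter_upwards [(mem_graph_nonlocalL2 hw).1 (LinearPMap.mem_graph _ f), isFourierL2_iff.1 hg]
    with ξ h1 h2
  rw [h1, h2]

end PadicNonlocal

end

theorem proposition1 (p : ℕ) [Fact p.Prime] (n : ℕ) (w : Qpn p n → ℝ)
    (hw : IsAdmissible w) (κ : ℝ) (hκ : 0 < κ) :
    -- the symbol is given by convergent integrals and depends on `‖ξ‖_p` only
    (∀ ξ : Qpn p n, Integrable (fun y => (1 - Psi (-dot y ξ)) / (w y : ℂ)) (haar p n)) ∧
    (∀ ξ η : Qpn p n, ‖ξ‖ = ‖η‖ → symbolA w ξ = symbolA w η) ∧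
    -- the operator on test functions
    (∀ φ : Qpn p n → ℂ, IsTestFunction φ →
      (∀ x, Integrable (fun y => (φ (x - y) - φ x) / (w y : ℂ)) (haar p n)) ∧
      Integrable (fun ξ => symbolA w ξ * fourierIntegral φ ξ) (haar p n) ∧
      (∀ x, nonlocalOp κ w φ x =
        -(κ : ℂ) * invFourierIntegral (fun ξ => symbolA w ξ * fourierIntegral φ ξ) x) ∧
      Continuous (nonlocalOp κ w φ) ∧
      ∀ ρ : ℝ≥0∞, 1 ≤ ρ → MemLp (nonlocalOp κ w φ) ρ (haar p n)) ∧
    -- its extension to an operator in `L²`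
    ∃ W : L2 p n →ₗ.[ℂ] L2 p n,
      (∀ φ : Qpn p n → ℂ, IsTestFunction φ → ∀ f : L2 p n, f =ᵐ[haar p n] φ →
        ∃ hf : f ∈ W.domain, W ⟨f, hf⟩ =ᵐ[haar p n] nonlocalOp κ w φ) ∧
      (∀ f : L2 p n, f ∈ W.domain ↔ ∃ g : Qpn p n → ℂ,
        IsFourierL2 f g ∧ MemLp (fun ξ => symbolA w ξ * g ξ) 2 (haar p n)) ∧
      (∀ (f : W.domain) (g : Qpn p n → ℂ), IsFourierL2 (f : L2 p n) g →
        IsFourierL2 (W f) fun ξ => -(κ : ℂ) * (symbolA w ξ * g ξ)) ∧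
      Dense (W.domain : Set (L2 p n)) ∧
      -- self-adjointness and positivity of `-W`
      IsSelfAdjoint (-W) ∧
      (∀ f : (-W).domain, 0 ≤ (inner ℂ ((-W) f) (f : L2 p n)).re) ∧
      -- the semigroup
      ∃ T : ℝ≥0 → L2 p n →L[ℂ] L2 p n,
        IsC0Semigroup T ∧
        (∀ t, ‖T t‖ ≤ 1) ∧
        IsGenerator W T ∧
        IsBoundedHolomorphic T (Real.pi / 2) := by
  have ha := measurable_realSymbol hw κ
  have ha0 := realSymbol_nonneg hw hκ.le
  refine ⟨integrable_symbolA hw, fun ξ η h => symbolA_radial hw h, fun φ hφ => ⟨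
    integrable_nonlocalOp_integrand hw hφ, integrable_symbolA_mul_fourierIntegral hw hφ,
    nonlocalOp_eq_invFourierIntegral hw κ hφ, continuous_nonlocalOp κ hφ, fun ρ hρ => ?_⟩,
    nonlocalL2 κ w, fun φ hφ f hf => nonlocalL2_extends hw κ hφ hf,
    fun f => mem_domain_nonlocalL2 hw hκ, fun f g hg => isFourierL2_nonlocalL2 hw f hg,
    SpectralMultiplier.dense_domain_multiplier ha ha0, ?_, ?_,
    fun t => SpectralMultiplier.expOp (fourierL2 p n) ha ha0 ((t : ℝ) : ℂ),
    SpectralMultiplier.isC0Semigroup_expOp ha ha0,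
    fun t => SpectralMultiplier.norm_expOp_le ha ha0 _,
    SpectralMultiplier.isGenerator_expOp ha ha0,
    SpectralMultiplier.isBoundedHolomorphic_expOp ha ha0⟩
  · obtain ⟨C, hC⟩ := exists_norm_nonlocalOp_le hw κ hφ
    exact (integrable_nonlocalOp hw κ hφ).memLp_of_norm_le hC hρ
  · rw [nonlocalL2, neg_neg]
    exact SpectralMultiplier.isSelfAdjoint_multiplier ha ha0
  · rw [nonlocalL2, neg_neg]
    exact fun f => (SpectralMultiplier.mulRel_multiplier f).inner_nonneg ha0
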